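/- Let $\theta$ be a critical or subcritical offspring distribution, i.e. a probability distribution on $\{0,1,2,\dots\}$ with $0<\theta(0)<1$ and mean $m=\sum_k k\,\theta(k)\le 1$. Let $g(x)=\sum_k\theta(k)x^k$ and let $g^{\circ r}$ denote its $r$-th iterate. **Trees and forests.** For a finite plane forest $f$ (a finite sequence of finite plane trees) of height exactly $s$ (the maximal height of its trees is $s$) and $0\le r\le s$, the reverse height of a vertex is $s$ minus its height, and $B_r(f)$ is the forest of the trees of descendants of the vertices of reverse height $r$, listed from left to right. An *infinite reverse tree* $\tau$ is a sequence $(B_r(\tau))_{r\ge 0}$ of nonempty finite plane forests such that $B_r(\tau)$ has height exactly $r$, $B_r(B_s(\tau))=B_r(\tau)$ for $r\le s$, and which is connected (for every $r$ there is $s\ge r$ such that all vertices of reverse height $r$ descend from one vertex of reverse height $s$). Infinite reverse trees are equipped with the $\sigma$-algebra generated by the events $\{B_r=f\}$. For a vertex $v$, $c_v$ is its number of children. The Galton–Watson (GW) tree with offspring distribution $\theta$ is equal to a finite plane tree $t$ with probability $\prod_{v\in t}\theta(c_v)$. **Spine construction.** Let $s_0,s_1,s_2,\dots$ be the vertices of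 a half-line (the spine), $s_r$ being the parent of $s_{r-1}$. Let $(L_r,R_r)_{r\ge1}$ be independent pairs with $$\mathbb P(L_r=i,R_r=j)=\frac{g^{\circ r}(0)-g^{\circ(r-1)}(0)}{g^{\circ(r+1)}(0)-g^{\circ r}(0)}\,\theta(i+j+1)\,g^{\circ(r-1)}(0)^i\,g^{\circ r}(0)^j\qquad(i,j\ge0,\ 0^0=1).$$ To the left of $s_r$ graft, by $L_r$ edges, $L_r$ GW trees conditioned to have height at most $r-2$ (note that $L_1=0$ a.s.), and to the right of $s_r$ graft, by $R_r$ edges, $R_r$ GW trees conditioned to have height at most $r-1$, all these trees and pairs being taken from one independent family. Let $d_r$ be the finite plane tree of descendants of $s_r$, where the children of $s_r$ are, from left to right, the roots of the left trees, $s_{r-1}$, and the roots of the right trees; the increasing union of the $d_r$ is the tree $\tau^0$, where $s_r$ has reverse height $r$. Then: 1. Random variables as in the spine construction exist. For any realization of them, $\tau^0$ is almost surely an infinite reverse tree: almost surely, for every $r$, the forest $B_r(d_n)$ does not depend on $n$ for $n$ large enough, and these eventual forests $B_r(\tau^0)$ form an infinite reverse tree. 2. $\tau^0$ is the local limit, seen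 from the last generation, of GW trees conditioned to die at generation $n$: if $T_n$ is a GW tree conditioned to have height exactly $n$, then for every $r\ge0$ the law of $B_r(T_n)$ converges to the law of $B_r(\tau^0)$ as $n\to\infty$, i.e. $\mathbb P(B_r(T_n)\in A)\to\mathbb P(B_r(\tau^0)\in A)$ for every set $A$ of finite plane forests. 3. Assume moreover that $\theta(1)>0$, and let $X$ be the GW process with offspring distribution $\theta$. For every $p\ge1$ the limit $$\pi(p)=\lim_{n\to\infty}\frac{\mathbb P_1(X(n)=p)}{\mathbb P_1(X(n)=1)}$$ (the quasi-stationary measure) exists and is finite, and so is $\Pi(\theta(0))$, where $\Pi(x)=\sum_{p\ge1}\pi(p)x^p$. For every $r\ge0$ and every forest $(t_1,\dots,t_p)$, $p\ge1$, of height exactly $r$, $$\mathbb P\big(B_r(\tau^0)=(t_1,\dots,t_p)\big)=\frac{\pi(p)\,m^{-r}}{\Pi(\theta(0))}\prod_{i=1}^p\prod_{v\in t_i}\theta(c_v).$$ The tree $\tau^0$ has exactly one vertex at reverse height $0$ with positive probability; if $\tau^1$ denotes $\tau^0$ conditioned on this event, then for every $r\ge0$ and every forest $(t_1,\dots,t_p)$,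 $p\ge1$, of height exactly $r$ with exactly one vertex at height $r$, $$\mathbb P\big(B_r(\tau^1)=(t_1,\dots,t_p)\big)=\frac{\pi(p)\,m^{-r}}{\theta(0)}\prod_{i=1}^p\prod_{v\in t_i}\theta(c_v).$$ Each of these two families of formulas characterizes the law of the corresponding infinite reverse tree among all laws of random infinite reverse trees. -/

import Mathlib

open MeasureTheory ProbabilityTheory Filter
open scoped ENNReal Topology

/-- Finite rooted plane trees: a vertex together with the ordered list, from left to right, of the
trees of descendants of its children. -/
inductive PlaneTree : Type
  | node : List PlaneTree → PlaneTree

namespace PlaneTree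

/-- The trees of descendants of the children of the root, from left to right. -/
def children : PlaneTree → List PlaneTree
  | node ts => ts

mutual
  /-- The height of a plane tree (a single vertex has height `0`). -/
  def height : PlaneTree → ℕ
    | node ts => heightAbove ts
  /-- The height of the tree obtained by attaching the given trees below a common root. -/
  def heightAbove : List PlaneTree → ℕ
    | [] => 0
    | t :: ts => max (height t + 1) (heightAbove ts)
end

mutual
  /-- The product of `θ (c_v)` over all vertices `v` of a plane tree, where `c_v` is the number of
  children of `v`. -/
  noncomputable def weight (θ : PMF ℕ) : PlaneTree → ℝ≥0∞
    | node ts => θ ts.length * forestWeight θ ts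
  /-- The product of `θ (c_v)` over all vertices `v` of a plane forest. -/
  noncomputable def forestWeight (θ : PMF ℕ) : List PlaneTree → ℝ≥0∞
    | [] => 1
    | t :: ts => weight θ t * forestWeight θ ts
end

/-- The maximal height of the trees of a plane forest. -/
def forestHeight (f : List PlaneTree) : ℕ := (f.map height).foldr max 0

/-- The trees of descendants of the vertices at height `k` of a plane forest, from left to
right. In particular the number of vertices at height `k` is the length of this list. -/
def descend (k : ℕ) (f : List PlaneTree) : List PlaneTree :=
  (fun h : List PlaneTree => h.flatMap children)^[k] f

instance : MeasurableSpace PlaneTree := ⊤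

end PlaneTree

open PlaneTree

/-- Infinite reverse trees, given by their balls: `ball r` is the finite forest consisting of the
trees of descendants of the vertices at reverse height `r`, listed from left to right. -/
structure InfiniteReverseTree where
  ball : ℕ → List PlaneTree
  ball_ne_nil : ∀ r, ball r ≠ []
  height_ball : ∀ r, forestHeight (ball r) = r
  ball_consistent : ∀ r s, r ≤ s → descend (s - r) (ball s) = ball r
  /-- The graph is connected: all the vertices at reverse height `r` have a common ancestor. -/
  connected : ∀ r, ∃ s, r ≤ s ∧ ∃ t ∈ ball s, descend (s - r) [t] = ball r

/-- The σ-algebra generated by the events `ball r = f`. -/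
instance : MeasurableSpace InfiniteReverseTree :=
  ⨆ r : ℕ, MeasurableSpace.comap (fun τ : InfiniteReverseTree => τ.ball r) ⊤

namespace GaltonWatson

/-- The mean of an offspring distribution, possibly infinite. -/
noncomputable def mean (θ : PMF ℕ) : ℝ≥0∞ := ∑' k : ℕ, (k : ℝ≥0∞) * θ k

/-- The generating function of an offspring distribution. -/
noncomputable def genFun (θ : PMF ℕ) (x : ℝ) : ℝ := ∑' k : ℕ, (θ k).toReal * x ^ k

/-- The law of the sum of `k` independent variables with law `θ`. -/
noncomputable def sumLaw (θ : PMF ℕ) : ℕ → PMF ℕ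
  | 0 => PMF.pure 0
  | k + 1 => θ.bind fun a => (sumLaw θ k).map fun b => a + b

/-- The law at time `n` of the Galton-Watson process with offspring distribution `θ` started
from one individual at time `0`. -/
noncomputable def processLaw (θ : PMF ℕ) : ℕ → PMF ℕ
  | 0 => PMF.pure 1
  | n + 1 => (processLaw θ n).bind (sumLaw θ)

/-- The ratio of the probabilities that the Galton-Watson process started from one individual is
equal to `p`, resp. to `1`, at time `n`. -/
noncomputable def ratio (θ : PMF ℕ) (p n : ℕ) : ℝ :=
  (processLaw θ n p).toReal / (processLaw θ n 1).toReal

/-- The quasi-stationary measure `π`, as the limit of the above ratios as `n → ∞`. -/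
noncomputable def quasiStat (θ : PMF ℕ) (p : ℕ) : ℝ := limUnder atTop (ratio θ p)

/-- The generating function `Π (x) = ∑_{p ≥ 1} π (p) x ^ p` of the quasi-stationary measure. -/
noncomputable def quasiStatGenFun (θ : PMF ℕ) (x : ℝ) : ℝ :=
  ∑' p : ℕ, quasiStat θ (p + 1) * x ^ (p + 1)

/-- The law of the Galton-Watson tree with offspring distribution `θ` on finite plane trees: the
probability of a tree `t` is the product of `θ (c_v)` over the vertices `v` of `t`. -/
noncomputable def treeLaw (θ : PMF ℕ) : Measure PlaneTree :=
  Measure.sum fun t => weight θ t • Measure.dirac t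

/-- `extinct θ r` is `g ∘ ⋯ ∘ g (0)` (`r` times), with `g` the generating function of `θ`. -/
noncomputable def extinct (θ : PMF ℕ) (r : ℕ) : ℝ := (genFun θ)^[r] 0

/-- The tree `d_r` of descendants of the vertex `s_r` of the spine, when for every `i ≥ 1` the
children of `s_i` are, from left to right, the roots of `t i 0, …, t i (L i - 1)`, then `s_{i-1}`,
then the roots of `u i 0, …, u i (R i - 1)`. -/
def spineSubtree (L R : ℕ → ℕ) (t u : ℕ → ℕ → PlaneTree) : ℕ → PlaneTree
  | 0 => node []
  | r + 1 => node ((List.range (L (r + 1))).map (t (r + 1)) ++ [spineSubtree L R t u r] ++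
      (List.range (R (r + 1))).map (u (r + 1)))

/-- `τ` is the infinite tree obtained from a spine, i.e. the increasing union of the trees `d_n`:
for every `r`, the trees of descendants of the vertices of `d_n` at reverse height `r` (that is,
at height `n - r` in `d_n`) form the forest `τ.ball r` for all `n` large enough. As these forests
grow with `n`, this means that the union has finitely many vertices at each reverse height, and
that its ball of radius `r` is `τ.ball r`. -/
def IsSpineTree (L R : ℕ → ℕ) (t u : ℕ → ℕ → PlaneTree) (τ : InfiniteReverseTree) : Prop :=
  ∀ r : ℕ, ∀ᶠ n : ℕ in atTop, descend (n - r) [spineSubtree L R t u n] = τ.ball r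

/-- The indices of the independent variables used in the spine construction: the pairs
`(L_{r+1}, R_{r+1})`, the left trees at `s_{r+2}` and the right trees at `s_{r+1}`, `r ≥ 0`. -/
inductive SpineIndex : Type
  | degree (r : ℕ) : SpineIndex
  | left (r j : ℕ) : SpineIndex
  | right (r j : ℕ) : SpineIndex

/-- The σ-algebras generated by the variables used in the spine construction. -/
@[reducible]
def spineSigma {Ω : Type*} (L R : ℕ → Ω → ℕ) (t u : ℕ → ℕ → Ω → PlaneTree) :
    SpineIndex → MeasurableSpace Ω
  | .degree r => MeasurableSpace.comap (fun ω => (L (r + 1) ω, R (r + 1) ω)) ⊤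
  | .left r j => MeasurableSpace.comap (t (r + 2) j) ⊤
  | .right r j => MeasurableSpace.comap (u (r + 1) j) ⊤

/-- The random variables of the spine construction. The pairs `(L_r, R_r)`, `r ≥ 1`, have the
prescribed joint laws; the trees grafted to the left of `s_r` are Galton-Watson trees conditioned
to have height at most `r - 2` (there are none for `r = 1`), those grafted to the right of `s_r`
are Galton-Watson trees conditioned to have height at most `r - 1`, and all these variables are
independent. Of the families `t r ·` and `u r ·` only the first `L_r`, resp. `R_r`, are used. -/
structure IsSpineConstruction (θ : PMF ℕ) {Ω : Type*} [MeasurableSpace Ω] (P : Measure Ω)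
    (L R : ℕ → Ω → ℕ) (t u : ℕ → ℕ → Ω → PlaneTree) : Prop where
  measurable_L : ∀ r, Measurable (L r)
  measurable_R : ∀ r, Measurable (R r)
  measurable_t : ∀ r j, Measurable (t r j)
  measurable_u : ∀ r j, Measurable (u r j)
  law_degree : ∀ r i j : ℕ, P.real {ω | L (r + 1) ω = i ∧ R (r + 1) ω = j} =
    (extinct θ (r + 1) - extinct θ r) / (extinct θ (r + 2) - extinct θ (r + 1)) *
      (θ (i + j + 1)).toReal * extinct θ r ^ i * extinct θ (r + 1) ^ j
  law_left : ∀ r j : ℕ, P.map (t (r + 2) j) = (treeLaw θ)[|{T | T.height ≤ r}]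
  law_right : ∀ r j : ℕ, P.map (u (r + 1) j) = (treeLaw θ)[|{T | T.height ≤ r}]
  indep : iIndep (spineSigma L R t u) P

/-- The law of the balls of `τ⁰`: for every `r ≥ 0` and every (nonempty) forest
`f = (t_1, …, t_p)` of height exactly `r`,
`ν (B_r = f) = π (p) m ^ (-r) / Π (θ (0)) * ∏_{v ∈ f} θ (c_v)`. -/
def HasBallLaw0 (θ : PMF ℕ) (ν : Measure InfiniteReverseTree) : Prop :=
  ∀ (r : ℕ) (f : List PlaneTree), f ≠ [] → forestHeight f = r →
    ν.real {τ | τ.ball r = f} =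
      quasiStat θ f.length * ((mean θ).toReal ^ r)⁻¹ / quasiStatGenFun θ (θ 0).toReal *
        (forestWeight θ f).toReal

/-- The law of the balls of `τ¹`: for every `r ≥ 0` and every (nonempty) forest
`f = (t_1, …, t_p)` of height exactly `r` with only one vertex at height `r`,
`ν (B_r = f) = π (p) m ^ (-r) / θ (0) * ∏_{v ∈ f} θ (c_v)`. -/
def HasBallLaw1 (θ : PMF ℕ) (ν : Measure InfiniteReverseTree) : Prop :=
  ∀ (r : ℕ) (f : List PlaneTree), f ≠ [] → forestHeight f = r → (descend r f).length = 1 →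
    ν.real {τ | τ.ball r = f} =
      quasiStat θ f.length * ((mean θ).toReal ^ r)⁻¹ / (θ 0).toReal * (forestWeight θ f).toReal

/-- The event `Y (0) = 1` that there is only one vertex at reverse height `0`. -/
def oneAtZero : Set InfiniteReverseTree := {τ | (τ.ball 0).length = 1}

end GaltonWatson

-- Write q_n for the probability that a GW tree has height less than n (`extinctMass`), h_n for the
-- probability that it has height n (`heightMass`), and D for the divided difference of g. Since
-- q_{n+1} = g(q_n), the ratio h_{n+1}/h_n equals D(q_n, q_{n+1}) (`growth`), which increases to
-- D(1,1) = m because q_n → 1.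
--
-- A tree of height n+1 splits uniquely at its leftmost child of height n: the trees to the left are
-- lower than n, those to the right lower than n+1. The weight factorizes along this splitting, and
-- the prescribed law of the pairs and grafted trees is exactly the resulting conditional law. Hence
-- d_n is a GW tree conditioned to have height n (`measure_spine`): all the conditioned trees live
-- on one probability space, each inside the next.
--
-- A tree grafted at level n comes within r generations of the last one with probability at most a
-- constant times an increment of `growth` over r+1 steps. These increments telescope and are
-- summable, since `growth` is bounded. By Borel–Cantelli the forests B_r(d_n) are almost surely
-- eventually constant in n, so the limit tree exists, and bounded convergence of indicators gives
-- the local limit on every set A.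
--
-- For the explicit laws, the branching property (`treeLaw_descend`) gives P(B_r(T_{n+r}) = f) =
-- P(X(n) = p) weight(f) / h_{n+r} for f with p trees and height r. At r = 0 the local limit shows
-- that P(X(n) = p)/h_n converges, with a positive limit for p = 1 when θ(1) > 0; ratios of these
-- limits are π(p), and total mass one yields Π(θ(0)). For general r the factor h_n/h_{n+r} → m^{-r}
-- appears. Uniqueness holds because balls of larger radius determine smaller ones, so the events
-- {B_r = f} form a π-system.

namespace PlaneTree

-- Plane trees and forests: countability, generations, heights

@[simp] theorem children_node (ts : List PlaneTree) : children (node ts) = ts := rfl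

@[simp] theorem node_children (t : PlaneTree) : node (children t) = t := by cases t; rfl

/-- The equivalence between plane trees and plane forests that removes the root. -/
def nodeEquiv : List PlaneTree ≃ PlaneTree where
  toFun := node
  invFun := children
  left_inv _ := rfl
  right_inv := node_children

theorem nodeEquiv_apply (ts : List PlaneTree) : nodeEquiv ts = node ts := rfl

theorem induct {p : PlaneTree → Prop} (h : ∀ ts, (∀ t ∈ ts, p t) → p (node ts)) : ∀ t, p t
  | node ts => h ts fun t _ => induct h t

/-- An injective code of plane trees by natural numbers. -/
def code : PlaneTree → ℕ
  | node ts => Encodable.encode (ts.attach.map fun t => code t.1)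
decreasing_by
  have := List.sizeOf_lt_of_mem t.2
  simp only [PlaneTree.node.sizeOf_spec]
  omega

theorem code_node (ts : List PlaneTree) : code (node ts) = Encodable.encode (ts.map code) := by
  rw [code]
  congr 1
  exact List.attach_map_val (f := code)

/-- Its purpose is countability: laws on trees and forests are then determined by singletons, and
finite products of these discrete spaces stay discrete. -/
theorem code_injective : Function.Injective code := by
  intro t
  induction t using induct with
  | h ts ih =>
    rintro ⟨us⟩ hu
    rw [code_node, code_node] at hu
    replace hu := Encodable.encode_injective hu
    congr 1
    induction ts generalizing us with
    | nil => simpa using hu.symm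
    | cons t ts iht =>
      cases us with
      | nil => simp at hu
      | cons u us =>
        simp only [List.map_cons, List.cons.injEq] at hu
        rw [ih t (by simp) hu.1, iht (fun a ha => ih a (by simp [ha])) us hu.2]

instance : Countable PlaneTree := code_injective.countable

instance : DiscreteMeasurableSpace PlaneTree := ⟨fun _ => trivial⟩

instance : MeasurableSpace (List PlaneTree) := ⊤

instance : DiscreteMeasurableSpace (List PlaneTree) := ⟨fun _ => trivial⟩

theorem height_node_lt_succ {ts : List PlaneTree} {n : ℕ} :
    height (node ts) < n + 1 ↔ ∀ t ∈ ts, height t < n := by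
  rw [height]
  induction ts with
  | nil => simp [heightAbove]
  | cons t ts ih =>
    rw [heightAbove, max_lt_iff, ih, List.forall_mem_cons, Nat.add_lt_add_iff_right]

theorem forestHeight_lt {f : List PlaneTree} {n : ℕ} (hf : f ≠ []) :
    forestHeight f < n ↔ ∀ t ∈ f, height t < n := by
  induction f with
  | nil => exact absurd rfl hf
  | cons t f ih =>
    have h : forestHeight (t :: f) = max (height t) (forestHeight f) := rfl
    rw [h, max_lt_iff]
    by_cases hf' : f = []
    · subst hf'
      simp only [List.mem_singleton, forall_eq, and_iff_left_iff_imp]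
      intro h1
      simp only [forestHeight, List.map_nil, List.foldr_nil]
      omega
    · rw [ih hf']
      simp

@[simp] theorem descend_zero (f : List PlaneTree) : descend 0 f = f := rfl

theorem descend_succ (k : ℕ) (f : List PlaneTree) :
    descend (k + 1) f = descend k (f.flatMap children) := rfl

theorem descend_add (j k : ℕ) (f : List PlaneTree) :
    descend (j + k) f = descend j (descend k f) :=
  Function.iterate_add_apply _ j k f

theorem descend_succ' (k : ℕ) (f : List PlaneTree) :
    descend (k + 1) f = (descend k f).flatMap children := by
  rw [add_comm, descend_add]
  rfl

theorem descend_node (k : ℕ) (ts : List PlaneTree) : descend (k + 1) [node ts] = descend k ts := by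
  simp [descend_succ]

theorem descend_append (k : ℕ) (f f' : List PlaneTree) :
    descend k (f ++ f') = descend k f ++ descend k f' := by
  induction k generalizing f f' with
  | zero => rfl
  | succ k ih => rw [descend_succ, List.flatMap_append, ih, descend_succ, descend_succ]

/-- Reduces heights to emptiness of generations, which compose well through `descend_add`. -/
theorem descend_eq_nil {k : ℕ} {f : List PlaneTree} :
    descend k f = [] ↔ ∀ t ∈ f, height t < k := by
  induction k generalizing f with
  | zero =>
    simp [List.eq_nil_iff_forall_not_mem]
  | succ k ih =>
    rw [descend_succ, ih]
    constructor
    · rintro h ⟨ts⟩ ht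
      exact height_node_lt_succ.2 fun s hs => h s (List.mem_flatMap.2 ⟨_, ht, hs⟩)
    · intro h s hs
      obtain ⟨⟨ts⟩, ht, hs⟩ := List.mem_flatMap.1 hs
      exact height_node_lt_succ.1 (h _ ht) s hs

theorem forestHeight_eq_iff {f : List PlaneTree} {n : ℕ} (hf : f ≠ []) :
    forestHeight f = n ↔ descend n f ≠ [] ∧ descend (n + 1) f = [] := by
  rw [ne_eq, descend_eq_nil, descend_eq_nil, ← forestHeight_lt hf, ← forestHeight_lt hf]
  omega

theorem height_eq_iff {t : PlaneTree} {n : ℕ} :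
    height t = n ↔ descend n [t] ≠ [] ∧ descend (n + 1) [t] = [] := by
  simp only [ne_eq, descend_eq_nil, List.mem_singleton, forall_eq]
  omega

/-- A ball of radius r and height r forces the height of the whole tree, so conditioning on the
height only adds a normalizing factor to the law of the ball. -/
theorem height_of_descend_eq {t : PlaneTree} {f : List PlaneTree} {k r : ℕ} (hf : f ≠ [])
    (hr : forestHeight f = r) (h : descend k [t] = f) : height t = r + k := by
  rw [forestHeight_eq_iff hf] at hr
  rw [height_eq_iff, descend_add, h, show r + k + 1 = r + 1 + k by ring, descend_add, h]
  exact hr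

theorem height_eq_zero {t : PlaneTree} : height t = 0 ↔ t = node [] := by
  rcases t with ⟨ts⟩
  rw [height_eq_iff]
  simp [descend_node]

-- Deterministic spines and the decomposition along the leftmost highest child

/-- The tree of descendants of the `n`-th vertex of a spine, `lf n` and `rf n` being the forests
grafted to the left and to the right of the `n + 1`-st vertex. -/
def spine (lf rf : ℕ → List PlaneTree) : ℕ → PlaneTree
  | 0 => node []
  | n + 1 => node (lf n ++ [spine lf rf n] ++ rf n)

theorem height_spine {lf rf : ℕ → List PlaneTree} (hl : ∀ n, ∀ t ∈ lf n, height t < n)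
    (hr : ∀ n, ∀ t ∈ rf n, height t < n + 1) (n : ℕ) : height (spine lf rf n) = n := by
  induction n with
  | zero => exact height_eq_zero.2 rfl
  | succ n ih =>
    apply le_antisymm
    · rw [← Nat.lt_succ_iff, spine, height_node_lt_succ]
      intro t ht
      simp only [List.append_assoc, List.mem_append, List.mem_cons, or_false,
        List.not_mem_nil] at ht
      rcases ht with ht | rfl | ht
      · exact (hl n t ht).trans (Nat.lt_succ_self n)
      · omega
      · exact hr n t ht
    · by_contra! h
      rw [spine, height_node_lt_succ] at h
      have := h (spine lf rf n) (by simp)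
      omega

theorem descend_spine_succ {lf rf : ℕ → List PlaneTree} (n k : ℕ) :
    descend (k + 1) [spine lf rf (n + 1)] =
      descend k (lf n) ++ descend k [spine lf rf n] ++ descend k (rf n) := by
  rw [spine, descend_node, descend_append, descend_append]

theorem spine_mem_descend (lf rf : ℕ → List PlaneTree) (n k : ℕ) :
    spine lf rf n ∈ descend k [spine lf rf (n + k)] := by
  induction k with
  | zero => simp
  | succ k ih =>
    rw [← add_assoc, descend_spine_succ]
    simp [ih]

/-- If the grafted forests almost never reach a given reverse height, then a spine gives an
infinite reverse tree. -/
theorem exists_infiniteReverseTree {lf rf : ℕ → List PlaneTree}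
    (hl : ∀ n, ∀ t ∈ lf n, height t < n) (hr : ∀ n, ∀ t ∈ rf n, height t < n + 1)
    (hE : ∀ r, ∀ᶠ n in atTop, ∀ t ∈ lf n ++ rf n, height t < n - r) :
    ∃ τ : InfiniteReverseTree, ∀ r, ∀ᶠ n : ℕ in atTop,
      descend (n - r) [spine lf rf n] = τ.ball r := by
  have key : ∀ r, ∃ f, ∀ᶠ n : ℕ in atTop, descend (n - r) [spine lf rf n] = f := by
    intro r
    obtain ⟨N, hN⟩ := eventually_atTop.1 ((hE r).and (eventually_ge_atTop r))
    refine ⟨descend (N - r) [spine lf rf N], eventually_atTop.2 ⟨N, fun n hn => ?_⟩⟩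
    induction n, hn using Nat.le_induction with
    | base => rfl
    | succ n hn ih =>
      obtain ⟨h1, h2⟩ := hN n hn
      -- Passing from n to n+1 adds only generation n - r of the forests grafted at level n, which
      -- is empty by `hE`.
      rw [Nat.succ_sub h2, descend_spine_succ, ih,
        descend_eq_nil.2 fun t ht => h1 t (List.mem_append_left _ ht),
        descend_eq_nil.2 fun t ht => h1 t (List.mem_append_right _ ht)]
      simp
  choose ball hball using key
  -- The spine vertex belongs to every ball; this gives nonemptiness now and a common ancestor
  -- later.
  have hmem : ∀ r, spine lf rf r ∈ ball r := by
    intro r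
    obtain ⟨n, hn, hnr⟩ := ((hball r).and (eventually_ge_atTop r)).exists
    rw [← hn]
    have := spine_mem_descend lf rf r (n - r)
    rwa [Nat.add_sub_cancel' hnr] at this
  have hne : ∀ r, ball r ≠ [] := fun r => List.ne_nil_of_mem (hmem r)
  refine ⟨⟨ball, hne, ?_, ?_, ?_⟩, hball⟩
  · intro r
    obtain ⟨n, hn, hnr⟩ := ((hball r).and (eventually_ge_atTop r)).exists
    have := height_of_descend_eq (hne r) rfl hn
    rw [height_spine hl hr] at this
    omega
  · intro r s hrs
    obtain ⟨n, ⟨hn, hn'⟩, hns⟩ :=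
      (((hball r).and (hball s)).and (eventually_ge_atTop s)).exists
    rw [← hn, ← hn', ← descend_add]
    congr 1
    omega
  · intro r
    obtain ⟨n, hn, hnr⟩ := ((hball r).and (eventually_ge_atTop r)).exists
    exact ⟨n, hnr, _, hmem n, hn⟩

/-- The bare spine; it serves as a default value off the almost sure event of convergence. -/
instance : Nonempty InfiniteReverseTree :=
  ⟨(exists_infiniteReverseTree (lf := fun _ => []) (rf := fun _ => []) (by simp) (by simp)
    (by simp)).choose⟩

/-- The spine decomposition of a tree of height `n + 1` along its leftmost child of height `n`. -/
theorem exists_spine_decomposition {ts : List PlaneTree} {n : ℕ}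
    (h : height (node ts) = n + 1) : ∃ l t u, ts = l ++ [t] ++ u ∧ (∀ s ∈ l, height s < n) ∧
      height t = n ∧ ∀ s ∈ u, height s < n + 1 := by
  have h1 : ∀ t ∈ ts, height t < n + 1 := height_node_lt_succ.1 (by omega)
  have h2 : ∃ t ∈ ts, n ≤ height t := by
    by_contra! h2
    have := height_node_lt_succ.2 h2
    omega
  clear h
  induction ts with
  | nil => simp at h2
  | cons t ts ih =>
    by_cases ht : height t = n
    · exact ⟨[], t, ts, by simp, by simp, ht, fun s hs => h1 s (by simp [hs])⟩
    · have h3 := h1 t (by simp)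
      obtain ⟨l, t', u, rfl, hl, ht', hu⟩ := ih (fun s hs => h1 s (by simp [hs])) (by
        obtain ⟨s, hs, hs'⟩ := h2
        rcases List.mem_cons.1 hs with rfl | hs
        · omega
        · exact ⟨s, hs, hs'⟩)
      refine ⟨t :: l, t', u, by simp, ?_, ht', hu⟩
      intro s hs
      rcases List.mem_cons.1 hs with rfl | hs
      · omega
      · exact hl s hs

/-- The marked tree is the first one of height n in the list, so only the trees on its left need a
height bound. -/
theorem spine_decomposition_unique {n : ℕ} {l l' u u' : List PlaneTree} {t t' : PlaneTree}
    (hl : ∀ s ∈ l, height s < n) (hl' : ∀ s ∈ l', height s < n) (ht : height t = n)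
    (ht' : height t' = n) (h : l ++ [t] ++ u = l' ++ [t'] ++ u') : l = l' ∧ t = t' ∧ u = u' := by
  induction l generalizing l' with
  | nil =>
    cases l' with
    | nil => simpa using h
    | cons s l' =>
      simp only [List.nil_append, List.cons_append, List.cons.injEq] at h
      have := hl' s (by simp)
      rw [← h.1] at this
      omega
  | cons s l ih =>
    cases l' with
    | nil =>
      simp only [List.nil_append, List.cons_append, List.cons.injEq] at h
      have := hl s (by simp)
      rw [h.1] at this
      omega
    | cons s' l' =>
      simp only [List.cons_append, List.cons.injEq] at h
      obtain ⟨h1, h2, h3⟩ := ih (fun a ha => hl a (by simp [ha]))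
        (fun a ha => hl' a (by simp [ha])) h.2
      exact ⟨by rw [h.1, h1], h2, h3⟩

end PlaneTree

namespace GaltonWatson

theorem spineSubtree_eq_spine (L R : ℕ → ℕ) (t u : ℕ → ℕ → PlaneTree) (n : ℕ) :
    spineSubtree L R t u n = spine (fun n => (List.range (L (n + 1))).map (t (n + 1)))
      (fun n => (List.range (R (n + 1))).map (u (n + 1))) n := by
  induction n with
  | zero => rfl
  | succ n ih => rw [spineSubtree, spine, ih]

end GaltonWatson

-- Sums of weights over forests

theorem ENNReal.tsum_list {α : Type*} (φ : List α → ℝ≥0∞) :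
    ∑' F, φ F = φ [] + ∑' a, ∑' F, φ (a :: F) := by
  classical
  let e : Option (α × List α) ≃ List α :=
    { toFun := fun o => o.elim [] fun p => p.1 :: p.2
      invFun := fun F => match F with
        | [] => none
        | a :: F => some (a, F)
      left_inv := by rintro (_ | ⟨a, F⟩) <;> rfl
      right_inv := by rintro (_ | ⟨a, F⟩) <;> rfl }
  have h (x : Option (α × List α)) : φ (e x) =
      (if x = none then φ [] else 0) + ∑' p : α × List α, if x = some p then φ (p.1 :: p.2) else 0 := by
    rcases x with _ | p
    · simp [e]
    · rw [tsum_eq_single p (by rintro q hq; simp [hq.symm])]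
      simp [e]
  rw [← e.tsum_eq φ, tsum_congr h, ENNReal.tsum_add, tsum_ite_eq, ENNReal.tsum_comm]
  congr 1
  rw [← ENNReal.tsum_prod (f := fun a F => φ (a :: F))]
  refine tsum_congr fun p => ?_
  rw [tsum_ite_eq]

theorem ENNReal.tsum_nat_prod_eq_antidiagonal (f : ℕ → ℕ → ℝ≥0∞) :
    ∑' i, ∑' j, f i j = ∑' k, ∑ i ∈ Finset.range (k + 1), f i (k - i) := by
  rw [← ENNReal.tsum_prod (f := f),
    ← Finset.HasAntidiagonal.sigmaAntidiagonalEquivProd.tsum_eq (fun p : ℕ × ℕ => f p.1 p.2),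
    ENNReal.tsum_sigma']
  congr 1
  ext k
  rw [tsum_fintype, ← Finset.Nat.sum_antidiagonal_eq_sum_range_succ]
  exact Finset.sum_coe_sort (Finset.HasAntidiagonal.antidiagonal k) (fun p : ℕ × ℕ => f p.1 p.2)

namespace GaltonWatson

theorem treeLaw_apply (θ : PMF ℕ) (S : Set PlaneTree) [DecidablePred (· ∈ S)] :
    treeLaw θ S = ∑' t, if t ∈ S then weight θ t else 0 := by
  rw [treeLaw, Measure.sum_apply _ .of_discrete]
  congr 1
  ext t
  rw [Measure.smul_apply, Measure.dirac_apply' _ .of_discrete, smul_eq_mul]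
  split_ifs with h <;> simp [h]

theorem treeLaw_singleton (θ : PMF ℕ) (t : PlaneTree) : treeLaw θ {t} = weight θ t := by
  classical
  rw [treeLaw_apply, tsum_eq_single t]
  · simp
  · intro s hs
    simp [hs]

@[simp] theorem forestWeight_nil (θ : PMF ℕ) : forestWeight θ [] = 1 := by rw [forestWeight]

@[simp] theorem forestWeight_cons (θ : PMF ℕ) (t : PlaneTree) (f : List PlaneTree) :
    forestWeight θ (t :: f) = weight θ t * forestWeight θ f := by rw [forestWeight]

theorem forestWeight_append (θ : PMF ℕ) (f f' : List PlaneTree) :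
    forestWeight θ (f ++ f') = forestWeight θ f * forestWeight θ f' := by
  induction f with
  | nil => simp
  | cons t f ih => simp [ih, mul_assoc]

theorem weight_node (θ : PMF ℕ) (ts : List PlaneTree) :
    weight θ (node ts) = θ ts.length * forestWeight θ ts := by rw [weight]

-- The weight is multiplicative, so the trees of a forest of given length behave as independent
-- copies of the GW tree.
open Classical in
theorem tsum_forestWeight_length (θ : PMF ℕ) (S : Set PlaneTree) (k : ℕ) :
    ∑' f : List PlaneTree, (if f.length = k ∧ ∀ t ∈ f, t ∈ S then forestWeight θ f else 0) =
      treeLaw θ S ^ k := by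
  induction k with
  | zero =>
    rw [ENNReal.tsum_list]
    simp
  | succ k ih =>
    rw [ENNReal.tsum_list, pow_succ', ← ih, treeLaw_apply, ← ENNReal.tsum_mul_right]
    simp only [List.length_nil, (Nat.succ_ne_zero k).symm, false_and, if_false, zero_add]
    congr 1
    ext t
    rw [← ENNReal.tsum_mul_left]
    congr 1
    ext f
    by_cases h : t ∈ S <;> simp [h]

open Classical in
theorem tsum_forestWeight (θ : PMF ℕ) (S : Set PlaneTree) (c : ℕ → ℝ≥0∞) :
    ∑' f : List PlaneTree, (if ∀ t ∈ f, t ∈ S then c f.length * forestWeight θ f else 0) =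
      ∑' k, c k * treeLaw θ S ^ k := by
  have : ∀ f : List PlaneTree, (if ∀ t ∈ f, t ∈ S then c f.length * forestWeight θ f else 0) =
      ∑' k, c k * (if f.length = k ∧ ∀ t ∈ f, t ∈ S then forestWeight θ f else 0) := by
    intro f
    rw [tsum_eq_single f.length]
    · simp
    · intro k hk
      simp [hk.symm]
  simp_rw [this]
  rw [ENNReal.tsum_comm]
  simp_rw [ENNReal.tsum_mul_left, tsum_forestWeight_length]

open Classical in
theorem tsum_forestWeight_mul (θ : PMF ℕ) (S S' : Set PlaneTree) (c : ℕ → ℕ → ℝ≥0∞) :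
    ∑' l : List PlaneTree, ∑' u : List PlaneTree,
      (if (∀ t ∈ l, t ∈ S) ∧ ∀ t ∈ u, t ∈ S' then
        c l.length u.length * (forestWeight θ l * forestWeight θ u) else 0) =
      ∑' i, ∑' j, c i j * (treeLaw θ S ^ i * treeLaw θ S' ^ j) := by
  have h1 := tsum_forestWeight θ S (fun i => ∑' j, c i j * treeLaw θ S' ^ j)
  calc _ = ∑' l : List PlaneTree, if ∀ t ∈ l, t ∈ S then
          (∑' j, c l.length j * treeLaw θ S' ^ j) * forestWeight θ l else 0 := by
        congr 1
        ext l
        split_ifs with h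
        · rw [← tsum_forestWeight, ← ENNReal.tsum_mul_right]
          congr 1
          ext u
          by_cases h' : ∀ t ∈ u, t ∈ S'
          · rw [if_pos ⟨h, h'⟩, if_pos h']
            ring
          · rw [if_neg (fun h2 => h' h2.2), if_neg h', zero_mul]
        · simp [h]
    _ = _ := by
        rw [h1]
        congr 1
        ext i
        rw [← ENNReal.tsum_mul_right]
        congr 1
        ext j
        ring

-- Generating function, extinction probabilities and the law of the height

/-- The generating function of an offspring distribution, with values in `[0, ∞]`. -/
noncomputable def pgf (θ : PMF ℕ) (x : ℝ≥0∞) : ℝ≥0∞ := ∑' k : ℕ, θ k * x ^ k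

/-- The divided difference of the generating function. -/
noncomputable def divDiff (θ : PMF ℕ) (x y : ℝ≥0∞) : ℝ≥0∞ :=
  ∑' i : ℕ, ∑' j : ℕ, θ (i + j + 1) * (x ^ i * y ^ j)

/-- The probability that the Galton-Watson tree is finite, of height less than `n`. -/
noncomputable def extinctMass (θ : PMF ℕ) (n : ℕ) : ℝ≥0∞ := treeLaw θ {T | T.height < n}

/-- The probability that the Galton-Watson tree has height `n`. -/
noncomputable def heightMass (θ : PMF ℕ) (n : ℕ) : ℝ≥0∞ := treeLaw θ {T | T.height = n}

/-- The ratio of the probabilities that the height is `n + 1`, resp. `n`. -/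
noncomputable def growth (θ : PMF ℕ) (n : ℕ) : ℝ≥0∞ :=
  divDiff θ (extinctMass θ n) (extinctMass θ (n + 1))

/-- Termwise factorization of a difference of powers by a geometric sum, written additively to avoid
truncated subtraction. -/
theorem pgf_add (θ : PMF ℕ) (x d : ℝ≥0∞) : pgf θ (x + d) = pgf θ x + divDiff θ x (x + d) * d := by
  have h : divDiff θ x (x + d) * d = ∑' k, θ (k + 1) *
      ((∑ i ∈ Finset.range (k + 1), (d + x) ^ i * x ^ (k + 1 - 1 - i)) * d) := by
    rw [divDiff, ENNReal.tsum_comm, ENNReal.tsum_nat_prod_eq_antidiagonal,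
      ← ENNReal.tsum_mul_right]
    congr 1
    ext k
    rw [Finset.sum_mul, Finset.sum_mul, Finset.mul_sum]
    refine Finset.sum_congr rfl fun i hi => ?_
    have : i ≤ k := Nat.lt_succ_iff.1 (Finset.mem_range.1 hi)
    rw [Nat.add_sub_cancel, show k - i + i + 1 = k + 1 by omega, add_comm d x]
    ring
  have h1 : ∀ y, pgf θ y = θ 0 + ∑' k, θ (k + 1) * y ^ (k + 1) := by
    intro y
    rw [pgf, tsum_eq_zero_add' ENNReal.summable]
    simp
  rw [h, h1, h1, add_assoc, ← ENNReal.tsum_add]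
  congr 2
  ext k
  rw [← mul_add, add_comm (x ^ (k + 1)), geom_sum₂_mul_add, add_comm d]

theorem divDiff_mono (θ : PMF ℕ) {x x' y y' : ℝ≥0∞} (hx : x ≤ x') (hy : y ≤ y') :
    divDiff θ x y ≤ divDiff θ x' y' := by
  unfold divDiff
  gcongr

theorem divDiff_one_one (θ : PMF ℕ) : divDiff θ 1 1 = mean θ := by
  have h : mean θ = ∑' k : ℕ, ((k + 1 : ℕ) : ℝ≥0∞) * θ (k + 1) := by
    rw [mean, tsum_eq_zero_add' ENNReal.summable, Nat.cast_zero, zero_mul, zero_add]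
  rw [divDiff, ENNReal.tsum_nat_prod_eq_antidiagonal, h]
  simp only [one_pow, mul_one]
  refine tsum_congr fun k => ?_
  rw [Finset.sum_congr rfl (g := fun _ => θ (k + 1))]
  · simp
  · intro i hi
    have : i ≤ k := Nat.lt_succ_iff.1 (Finset.mem_range.1 hi)
    rw [show i + (k - i) + 1 = k + 1 by omega]

theorem extinctMass_zero (θ : PMF ℕ) : extinctMass θ 0 = 0 := by simp [extinctMass]

theorem extinctMass_succ (θ : PMF ℕ) (n : ℕ) : extinctMass θ (n + 1) = pgf θ (extinctMass θ n) := by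
  classical
  rw [pgf, extinctMass, extinctMass, ← tsum_forestWeight, treeLaw_apply, ← nodeEquiv.tsum_eq]
  refine tsum_congr fun ts => ?_
  rw [nodeEquiv_apply, weight_node]
  by_cases h : ∀ t ∈ ts, t ∈ {T : PlaneTree | T.height < n}
  · rw [if_pos h]
    exact if_pos (height_node_lt_succ.2 h)
  · rw [if_neg h]
    exact if_neg fun h' => h (height_node_lt_succ.1 h')

theorem extinctMass_add_heightMass (θ : PMF ℕ) (n : ℕ) :
    extinctMass θ n + heightMass θ n = extinctMass θ (n + 1) := by
  rw [extinctMass, heightMass, extinctMass, ← measure_union _ .of_discrete]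
  · congr 1
    ext T
    simp only [Set.mem_union, Set.mem_ofPred_eq]
    omega
  · rw [Set.disjoint_left]
    intro T h h'
    simp only [Set.mem_ofPred_eq] at h h'
    omega

theorem pgf_le_one (θ : PMF ℕ) {x : ℝ≥0∞} (hx : x ≤ 1) : pgf θ x ≤ 1 := by
  rw [← θ.tsum_coe, pgf]
  exact ENNReal.tsum_le_tsum fun k => mul_le_of_le_one_right' (pow_le_one' hx k)

theorem extinctMass_le_one (θ : PMF ℕ) (n : ℕ) : extinctMass θ n ≤ 1 := by
  induction n with
  | zero => simp [extinctMass_zero]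
  | succ n ih => rw [extinctMass_succ]; exact pgf_le_one θ ih

theorem extinctMass_ne_top (θ : PMF ℕ) (n : ℕ) : extinctMass θ n ≠ ∞ :=
  ((extinctMass_le_one θ n).trans_lt ENNReal.one_lt_top).ne

theorem extinctMass_mono (θ : PMF ℕ) : Monotone (extinctMass θ) :=
  monotone_nat_of_le_succ fun n => by
    rw [← extinctMass_add_heightMass]
    exact le_self_add

theorem heightMass_zero (θ : PMF ℕ) : heightMass θ 0 = θ 0 := by
  have : {T : PlaneTree | T.height = 0} = {node []} := by
    ext T
    simp [height_eq_zero]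
  rw [heightMass, this, treeLaw_singleton, weight_node]
  simp

theorem heightMass_le_one (θ : PMF ℕ) (n : ℕ) : heightMass θ n ≤ 1 :=
  le_trans (by rw [← extinctMass_add_heightMass]; exact le_add_self) (extinctMass_le_one θ (n + 1))

theorem heightMass_ne_top (θ : PMF ℕ) (n : ℕ) : heightMass θ n ≠ ∞ :=
  ((heightMass_le_one θ n).trans_lt ENNReal.one_lt_top).ne

/-- Apply `pgf_add` at q_n with increment h_n and cancel the finite q_{n+1}. Thus the prefactor in
the law of the pairs is the inverse of `growth`, and the pair law has total mass one. -/
theorem heightMass_succ (θ : PMF ℕ) (n : ℕ) : heightMass θ (n + 1) = growth θ n * heightMass θ n := by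
  have h := pgf_add θ (extinctMass θ n) (heightMass θ n)
  rw [extinctMass_add_heightMass, ← extinctMass_succ, ← extinctMass_succ,
    ← extinctMass_add_heightMass θ (n + 1)] at h
  exact (ENNReal.add_right_inj (extinctMass_ne_top θ _)).1 h

theorem growth_mono (θ : PMF ℕ) : Monotone (growth θ) := fun _ _ h =>
  divDiff_mono θ (extinctMass_mono θ h) (extinctMass_mono θ (by omega))

theorem growth_le_mean (θ : PMF ℕ) (n : ℕ) : growth θ n ≤ mean θ := by
  rw [← divDiff_one_one]
  exact divDiff_mono θ (extinctMass_le_one θ _) (extinctMass_le_one θ _)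

theorem exists_succ_pos (θ : PMF ℕ) (h1 : θ 0 < 1) : ∃ k, 0 < θ (k + 1) := by
  by_contra! h
  have := θ.tsum_coe
  rw [tsum_eq_single 0] at this
  · exact h1.ne this
  · rintro (_ | k) hk
    · exact absurd rfl hk
    · exact le_antisymm (h k) zero_le

theorem growth_pos (θ : PMF ℕ) (h0 : 0 < θ 0) (h1 : θ 0 < 1) (n : ℕ) : 0 < growth θ n := by
  refine lt_of_lt_of_le ?_ (growth_mono θ (Nat.zero_le n))
  obtain ⟨k, hk⟩ := exists_succ_pos θ h1
  have he : extinctMass θ (0 + 1) = θ 0 := by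
    rw [← extinctMass_add_heightMass, extinctMass_zero, heightMass_zero, zero_add]
  -- As q_0 = 0, only the terms with i = 0 survive in D(q_0, q_1), thanks to 0^0 = 1.
  have h2 : 0 < θ (0 + k + 1) * (extinctMass θ 0 ^ 0 * extinctMass θ (0 + 1) ^ k) := by
    rw [he, pow_zero, one_mul, zero_add]
    exact ENNReal.mul_pos hk.ne' (pow_ne_zero k h0.ne')
  refine h2.trans_le ?_
  rw [growth, divDiff]
  exact (ENNReal.le_tsum k).trans
    (ENNReal.le_tsum (f := fun i => ∑' j, θ (i + j + 1) *
      (extinctMass θ 0 ^ i * extinctMass θ (0 + 1) ^ j)) 0)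

theorem heightMass_pos (θ : PMF ℕ) (h0 : 0 < θ 0) (h1 : θ 0 < 1) (n : ℕ) : 0 < heightMass θ n := by
  induction n with
  | zero => rwa [heightMass_zero]
  | succ n ih =>
    rw [heightMass_succ]
    exact ENNReal.mul_pos (growth_pos θ h0 h1 n).ne' ih.ne'

theorem extinctMass_succ_pos (θ : PMF ℕ) (h0 : 0 < θ 0) (h1 : θ 0 < 1) (n : ℕ) :
    0 < extinctMass θ (n + 1) := by
  rw [← extinctMass_add_heightMass]
  exact (heightMass_pos θ h0 h1 n).trans_le le_add_self

theorem pgf_toReal (θ : PMF ℕ) {x : ℝ≥0∞} (hx : x ≤ 1) : (pgf θ x).toReal = genFun θ x.toReal := by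
  rw [pgf, ENNReal.tsum_toReal_eq, genFun]
  · simp
  · intro k
    exact ENNReal.mul_ne_top (θ.apply_ne_top k)
      (ENNReal.pow_ne_top (hx.trans_lt ENNReal.one_lt_top).ne)

theorem extinct_eq (θ : PMF ℕ) (n : ℕ) : extinct θ n = (extinctMass θ n).toReal := by
  induction n with
  | zero => simp [extinct, extinctMass_zero]
  | succ n ih =>
    rw [extinctMass_succ, pgf_toReal θ (extinctMass_le_one θ n), ← ih, extinct, extinct,
      Function.iterate_succ_apply']

theorem extinct_succ_sub (θ : PMF ℕ) (n : ℕ) :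
    extinct θ (n + 1) - extinct θ n = (heightMass θ n).toReal := by
  rw [extinct_eq, extinct_eq, ← extinctMass_add_heightMass,
    ENNReal.toReal_add (extinctMass_ne_top θ n) (heightMass_ne_top θ n)]
  ring

-- The branching property

open Classical in
/-- One step of the branching property. -/
theorem tsum_forestWeight_flatMap_children (θ : PMF ℕ) (p : ℕ) (f : List PlaneTree) :
    ∑' F : List PlaneTree, (if F.length = p ∧ F.flatMap children = f then forestWeight θ F else 0) =
      sumLaw θ p f.length * forestWeight θ f := by
  induction p generalizing f with
  | zero =>
    rw [ENNReal.tsum_list, sumLaw, PMF.pure_apply]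
    simp only [List.length_nil, List.flatMap_nil, true_and, forestWeight_nil, List.length_cons,
      Nat.add_eq_zero_iff, one_ne_zero, and_false, false_and, if_false, tsum_zero, add_zero,
      List.length_eq_zero_iff]
    by_cases h : f = []
    · simp [h]
    · simp [h, Ne.symm h]
  | succ p ih =>
    have hL : ∑' (ts : List PlaneTree) (F : List PlaneTree),
        (if (nodeEquiv ts :: F).length = p + 1 ∧ (nodeEquiv ts :: F).flatMap children = f then
          forestWeight θ (nodeEquiv ts :: F) else 0) =
        ∑' ts : List PlaneTree, (θ ts.length * forestWeight θ ts) * ∑' F : List PlaneTree,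
          (if F.length = p ∧ ts ++ F.flatMap children = f then forestWeight θ F else 0) := by
      simp_rw [← ENNReal.tsum_mul_left]
      refine tsum_congr fun ts => tsum_congr fun F => ?_
      rw [forestWeight_cons, nodeEquiv_apply, weight_node, mul_ite, mul_zero]
      refine if_congr ?_ rfl rfl
      simp
    rw [ENNReal.tsum_list, ← nodeEquiv.tsum_eq, hL]
    simp only [List.length_nil, (Nat.succ_ne_zero p).symm, false_and, if_false, zero_add]
    -- Sort by the number a of children of the first root: these children must then be the first a
    -- trees of f, and the remaining roots account for the rest.
    have hfib : ∀ φ : List PlaneTree → ℝ≥0∞,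
        ∑' ts, φ ts = ∑' a : ℕ, ∑' ts : List PlaneTree, if ts.length = a then φ ts else 0 := by
      intro φ
      rw [ENNReal.tsum_comm]
      congr 1
      ext ts
      rw [tsum_eq_single ts.length]
      · simp
      · intro a ha
        simp [ha.symm]
    rw [hfib, sumLaw, PMF.bind_apply, ← ENNReal.tsum_mul_right]
    congr 1
    ext a
    rw [PMF.map_apply]
    by_cases ha : a ≤ f.length
    · rw [tsum_eq_single (f.take a), tsum_eq_single (f.length - a)]
      · have h1 : (f.take a).length = a := by simp [ha]
        have h2 : ∀ F : List PlaneTree, (F.length = p ∧ f.take a ++ F.flatMap children = f) ↔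
            (F.length = p ∧ F.flatMap children = f.drop a) := by
          intro F
          refine and_congr_right fun _ => ?_
          conv_lhs => rhs; rw [← List.take_append_drop a f]
          rw [List.append_cancel_left_eq]
        have h3 : (f.drop a).length = f.length - a := by simp
        simp only [h1, if_true, h2, ih, h3]
        rw [if_pos (by omega)]
        conv_rhs => rw [← List.take_append_drop a f, forestWeight_append]
        simp only [List.take_append_drop]
        ring
      · intro b hb
        rw [if_neg (by omega)]
      · intro ts hts
        split_ifs with h1
        · rw [ENNReal.tsum_eq_zero.2, mul_zero]
          intro F
          rw [if_neg]
          rintro ⟨-, h2⟩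
          apply hts
          rw [← h2, ← h1]
          simp
        · rfl
    · rw [ENNReal.tsum_eq_zero.2, ENNReal.tsum_eq_zero.2]
      · simp
      · intro b
        rw [if_neg (by omega)]
      · intro ts
        split_ifs with h1
        · rw [ENNReal.tsum_eq_zero.2, mul_zero]
          intro F
          rw [if_neg]
          rintro ⟨-, h2⟩
          apply ha
          rw [← h2, ← h1]
          simp
        · rfl

/-- The branching property: given that there are `p` vertices at height `k`, their trees of
descendants are independent Galton-Watson trees. -/
theorem treeLaw_descend (θ : PMF ℕ) (k : ℕ) (f : List PlaneTree) :
    treeLaw θ {T | descend k [T] = f} = processLaw θ k f.length * forestWeight θ f := by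
  classical
  induction k generalizing f with
  | zero =>
    rw [processLaw, PMF.pure_apply]
    split_ifs with h
    · obtain ⟨t, rfl⟩ := List.length_eq_one_iff.1 h
      have : {T | descend 0 [T] = [t]} = {t} := by ext T; simp
      rw [this, treeLaw_singleton]
      simp
    · have : {T | descend 0 [T] = f} = ∅ := by
        ext T
        simp only [descend_zero, Set.mem_ofPred_eq, Set.mem_empty_iff_false, iff_false]
        rintro rfl
        simp at h
      rw [this]
      simp
  | succ k ih =>
    -- Partition according to the forest found at generation k, whose roots' children form f.
    have h1 : {T | descend (k + 1) [T] = f} =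
        ⋃ F : {F : List PlaneTree // F.flatMap children = f}, {T | descend k [T] = F.1} := by
      ext T
      simp [descend_succ']
    rw [h1, measure_iUnion]
    · simp_rw [ih]
      rw [processLaw, PMF.bind_apply, ← ENNReal.tsum_mul_right]
      simp_rw [mul_assoc, ← tsum_forestWeight_flatMap_children, ← ENNReal.tsum_mul_left]
      rw [ENNReal.tsum_comm]
      refine (tsum_subtype {F : List PlaneTree | F.flatMap children = f}
        (fun F => processLaw θ k F.length * forestWeight θ F)).trans ?_
      congr 1
      ext F
      rw [tsum_eq_single F.length]
      · simp [Set.indicator]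
      · intro b hb
        simp [hb.symm]
    · rintro ⟨F, hF⟩ ⟨F', hF'⟩ hne
      rw [Function.onFun, Set.disjoint_left]
      intro T h h'
      exact hne (Subtype.ext (h.symm.trans h'))
    · exact fun _ => .of_discrete

-- The spine variables: measurability, independence, law of d_n

theorem measurable_map_range {Ω : Type*} {m : MeasurableSpace Ω} {N : Ω → ℕ}
    {x : ℕ → Ω → PlaneTree} (hN : Measurable N) (hx : ∀ j, Measurable (x j)) :
    Measurable fun ω => (List.range (N ω)).map fun j => x j ω := by
  have h : ∀ n, Measurable fun ω => (List.range n).map fun j => x j ω := by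
    intro n
    induction n with
    | zero => exact measurable_const
    | succ n ih =>
      simp_rw [List.range_succ, List.map_append]
      exact (Measurable.of_discrete (f := fun p : List PlaneTree × PlaneTree =>
        p.1 ++ [p.2])).comp (ih.prodMk (hx n))
  exact (measurable_from_prod_countable_right
    (f := fun p : ℕ × Ω => (List.range p.1).map fun j => x j p.2) h).comp
      (hN.prodMk measurable_id)

theorem measurable_spine {Ω : Type*} {m : MeasurableSpace Ω} {lf rf : ℕ → Ω → List PlaneTree}
    {n : ℕ} (hl : ∀ k < n, Measurable (lf k)) (hr : ∀ k < n, Measurable (rf k)) :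
    Measurable fun ω => spine (fun k => lf k ω) (fun k => rf k ω) n := by
  induction n with
  | zero => exact measurable_const
  | succ n ih =>
    have ih := ih (fun k hk => hl k (by omega)) (fun k hk => hr k (by omega))
    exact (Measurable.of_discrete (f := fun p : List PlaneTree × PlaneTree × List PlaneTree =>
      node (p.1 ++ [p.2.1] ++ p.2.2))).comp
      ((hl n (by omega)).prodMk (ih.prodMk (hr n (by omega))))

theorem map_range_eq_iff {n : ℕ} {x : ℕ → PlaneTree} {l : List PlaneTree} :
    (List.range n).map x = l ↔ n = l.length ∧ ∀ k < l.length, x k = l.getD k (node []) := by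
  constructor
  · rintro rfl
    simp +contextual
  · rintro ⟨rfl, h⟩
    apply List.ext_getElem
    · simp
    · intro k h1 h2
      rw [List.getElem_map, List.getElem_range, h k h2, List.getD_eq_getElem _ _ h2]

-- The power of e coming from the law of the pair cancels the normalizations of the conditioned
-- trees, leaving plain weights.
open Classical in
theorem pow_mul_prod_treeLaw (θ : PMF ℕ) {e : ℝ≥0∞} (h0 : e ≠ 0) (h1 : e ≠ ∞) (n : ℕ)
    (l : List PlaneTree) :
    e ^ l.length * ∏ k ∈ Finset.range l.length,
      (e⁻¹ * treeLaw θ ({T | T.height < n} ∩ {l.getD k (node [])})) =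
      if ∀ t ∈ l, t.height < n then forestWeight θ l else 0 := by
  induction l with
  | nil => simp
  | cons t l ih =>
    rw [List.length_cons, Finset.prod_range_succ', pow_succ]
    simp only [List.getD_cons_succ, List.getD_cons_zero]
    have : ∀ a b c : ℝ≥0∞, a * e * (b * (e⁻¹ * c)) = (e * e⁻¹) * ((a * b) * c) := by
      intros; ring
    rw [this, ih, ENNReal.mul_inv_cancel h0 h1, one_mul]
    by_cases ht : t.height < n
    · have : {T : PlaneTree | T.height < n} ∩ {t} = {t} := by
        rw [Set.inter_eq_right]
        simpa using ht
      rw [this, treeLaw_singleton]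
      simp [ht, mul_comm]
    · have : {T : PlaneTree | T.height < n} ∩ {t} = ∅ := by
        rw [Set.inter_singleton_eq_empty]
        simpa using ht
      rw [this]
      simp [ht]

/-- The forest grafted to the left of the vertex `s_{n+1}` of the spine. -/
def leftForest {Ω : Type*} (L : ℕ → Ω → ℕ) (t : ℕ → ℕ → Ω → PlaneTree) (n : ℕ) (ω : Ω) :
    List PlaneTree :=
  -- The law of `t 1` is unconstrained; as L_1 = 0 almost surely, forcing the empty forest changes
  -- nothing up to a null set.
  if n = 0 then [] else (List.range (L (n + 1) ω)).map fun j => t (n + 1) j ω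

/-- The forest grafted to the right of the vertex `s_{n+1}` of the spine. -/
def rightForest {Ω : Type*} (R : ℕ → Ω → ℕ) (u : ℕ → ℕ → Ω → PlaneTree) (n : ℕ) (ω : Ω) :
    List PlaneTree :=
  (List.range (R (n + 1) ω)).map fun j => u (n + 1) j ω

theorem measurable_leftForest {Ω : Type*} {m : MeasurableSpace Ω} {L : ℕ → Ω → ℕ}
    {t : ℕ → ℕ → Ω → PlaneTree} {n : ℕ} (hL : Measurable (L (n + 1)))
    (ht : n ≠ 0 → ∀ j, Measurable (t (n + 1) j)) : Measurable (leftForest L t n) := by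
  unfold leftForest
  split_ifs with h
  · exact measurable_const
  · exact measurable_map_range hL (ht h)

theorem measurable_rightForest {Ω : Type*} {m : MeasurableSpace Ω} {R : ℕ → Ω → ℕ}
    {u : ℕ → ℕ → Ω → PlaneTree} {n : ℕ} (hR : Measurable (R (n + 1)))
    (hu : ∀ j, Measurable (u (n + 1) j)) : Measurable (rightForest R u n) :=
  measurable_map_range hR hu

/-- The index of the vertex of the spine at which a variable is used, minus one. -/
def SpineIndex.level : SpineIndex → ℕ
  | .degree r => r
  | .left r _ => r + 1
  | .right r _ => r

namespace IsSpineConstruction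

variable {θ : PMF ℕ} {Ω : Type*} [mΩ : MeasurableSpace Ω] {P : Measure Ω}
  {L R : ℕ → Ω → ℕ} {t u : ℕ → ℕ → Ω → PlaneTree}

theorem spineSigma_le (hC : IsSpineConstruction θ P L R t u) (i : SpineIndex) :
    spineSigma L R t u i ≤ mΩ := by
  cases i with
  | degree r =>
    rintro _ ⟨S, -, rfl⟩
    exact (hC.measurable_L (r + 1)).prodMk (hC.measurable_R (r + 1)) (.of_discrete (s := S))
  | left r j => exact (hC.measurable_t _ _).comap_le
  | right r j => exact (hC.measurable_u _ _).comap_le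

theorem measure_left (hC : IsSpineConstruction θ P L R t u) (r j : ℕ) (S : Set PlaneTree) :
    P (t (r + 2) j ⁻¹' S) =
      (extinctMass θ (r + 1))⁻¹ * treeLaw θ ({T | T.height < r + 1} ∩ S) := by
  rw [← Measure.map_apply (hC.measurable_t _ _) .of_discrete, hC.law_left,
    cond_apply .of_discrete, extinctMass]
  simp_rw [Nat.lt_succ_iff]

theorem measure_right (hC : IsSpineConstruction θ P L R t u) (r j : ℕ) (S : Set PlaneTree) :
    P (u (r + 1) j ⁻¹' S) =
      (extinctMass θ (r + 1))⁻¹ * treeLaw θ ({T | T.height < r + 1} ∩ S) := by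
  rw [← Measure.map_apply (hC.measurable_u _ _) .of_discrete, hC.law_right,
    cond_apply .of_discrete, extinctMass]
  simp_rw [Nat.lt_succ_iff]

/-- Independence of the finitely many variables read at one level. The condition `hi` excludes left
trees at s_1, which are not in the independent family. -/
theorem measure_level_inter (hC : IsSpineConstruction θ P L R t u) (n i j : ℕ)
    (hi : n = 0 → i = 0) (A B : ℕ → Set PlaneTree) :
    P {ω | (L (n + 1) ω = i ∧ R (n + 1) ω = j) ∧ (∀ k < i, t (n + 1) k ω ∈ A k) ∧
      ∀ k < j, u (n + 1) k ω ∈ B k} =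
      P {ω | L (n + 1) ω = i ∧ R (n + 1) ω = j} *
        ((∏ k ∈ Finset.range i, P (t (n + 1) k ⁻¹' A k)) *
          ∏ k ∈ Finset.range j, P (u (n + 1) k ⁻¹' B k)) := by
  classical
  let F : SpineIndex → Set Ω := fun x => match x with
    | .degree _ => {ω | L (n + 1) ω = i ∧ R (n + 1) ω = j}
    | .left _ k => t (n + 1) k ⁻¹' A k
    | .right _ k => u (n + 1) k ⁻¹' B k
  let s : Finset SpineIndex := insert (.degree n)
    -- The left trees at s_{n+1} carry the index n - 1; for n = 0 this image is empty.
    ((Finset.range i).image (.left (n - 1)) ∪ (Finset.range j).image (.right n))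
  have h := hC.indep.meas_biInter (S := s) (s := F) (by
    intro x hx
    simp only [s, Finset.mem_insert, Finset.mem_union, Finset.mem_image, Finset.mem_range] at hx
    rcases hx with rfl | ⟨k, hk, rfl⟩ | ⟨k, hk, rfl⟩
    · exact ⟨{(i, j)}, trivial, by ext ω; simp [F]⟩
    · have hn : n ≠ 0 := fun hn => by simp [hi hn] at hk
      obtain ⟨n, rfl⟩ := Nat.exists_eq_succ_of_ne_zero hn
      exact ⟨A k, trivial, rfl⟩
    · exact ⟨B k, trivial, rfl⟩)
  have hd : Disjoint ((Finset.range i).image (SpineIndex.left (n - 1)))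
      ((Finset.range j).image (SpineIndex.right n)) := by
    rw [Finset.disjoint_left]
    intro x hx hx'
    obtain ⟨k, -, rfl⟩ := Finset.mem_image.1 hx
    simp at hx'
  have hs : ⋂ x ∈ s, F x = {ω | (L (n + 1) ω = i ∧ R (n + 1) ω = j) ∧
      (∀ k < i, t (n + 1) k ω ∈ A k) ∧ ∀ k < j, u (n + 1) k ω ∈ B k} := by
    ext ω
    simp only [s, Finset.mem_insert, Finset.mem_union, Finset.mem_image, Finset.mem_range,
      Set.mem_iInter, Set.mem_ofPred_eq]
    constructor
    · intro h
      exact ⟨h (.degree n) (Or.inl rfl), fun k hk => h (.left (n - 1) k) (Or.inr (Or.inl ⟨k, hk, rfl⟩)),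
        fun k hk => h (.right n k) (Or.inr (Or.inr ⟨k, hk, rfl⟩))⟩
    · rintro ⟨h1, h2, h3⟩ x (rfl | ⟨k, hk, rfl⟩ | ⟨k, hk, rfl⟩)
      · exact h1
      · exact h2 k hk
      · exact h3 k hk
  rw [← hs, h, Finset.prod_insert (by simp), Finset.prod_union hd, Finset.prod_image (by simp),
    Finset.prod_image (by simp)]

theorem measurable_forests (hC : IsSpineConstruction θ P L R t u) (n : ℕ) :
    Measurable (leftForest L t n) ∧ Measurable (rightForest R u n) :=
  ⟨measurable_leftForest (hC.measurable_L _) fun _ => hC.measurable_t _,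
    measurable_rightForest (hC.measurable_R _) (hC.measurable_u _)⟩

theorem measurable_spine (hC : IsSpineConstruction θ P L R t u) (n : ℕ) :
    Measurable fun ω => spine (fun k => leftForest L t k ω) (fun k => rightForest R u k ω) n :=
  GaltonWatson.measurable_spine (fun k _ => (hC.measurable_forests k).1)
    (fun k _ => (hC.measurable_forests k).2)

/-- The tree d_n uses only variables of level below n and the forests at s_{n+1} only those of level
n: disjoint blocks of an independent family. -/
theorem measure_spine_and_forests (hC : IsSpineConstruction θ P L R t u) (n : ℕ) (T : PlaneTree)
    (l r : List PlaneTree) :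
    P {ω | spine (fun k => leftForest L t k ω) (fun k => rightForest R u k ω) n = T ∧
      leftForest L t n ω = l ∧ rightForest R u n ω = r} =
      P {ω | spine (fun k => leftForest L t k ω) (fun k => rightForest R u k ω) n = T} *
        P {ω | leftForest L t n ω = l ∧ rightForest R u n ω = r} := by
  have hI := indep_iSup_of_disjoint hC.spineSigma_le hC.indep
    (S := {i | i.level < n}) (T := {i | i.level = n}) (by
      rw [Set.disjoint_left]
      intro i hi hi'
      simp only [Set.mem_ofPred_eq] at hi hi'
      omega)
  have hmeas : ∀ (k : ℕ) (S : Set SpineIndex), (∀ i, i.level = k → i ∈ S) →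
      Measurable[⨆ i ∈ S, spineSigma L R t u i] (leftForest L t k) ∧
      Measurable[⨆ i ∈ S, spineSigma L R t u i] (rightForest R u k) := by
    intro k S hS
    have hle : ∀ i, i.level = k → spineSigma L R t u i ≤ ⨆ i ∈ S, spineSigma L R t u i :=
      fun i hi => le_iSup₂_of_le i (hS i hi) le_rfl
    have hdeg : @Measurable _ _ (⨆ i ∈ S, spineSigma L R t u i) ⊤
        (fun ω => (L (k + 1) ω, R (k + 1) ω)) :=
      (comap_measurable (m := ⊤) _).mono (hle (.degree k) rfl) le_rfl
    refine ⟨measurable_leftForest ((measurable_from_top (f := Prod.fst)).comp hdeg) ?_,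
      measurable_rightForest ((measurable_from_top (f := Prod.snd)).comp hdeg) ?_⟩
    · intro hk j
      obtain ⟨k, rfl⟩ := Nat.exists_eq_succ_of_ne_zero hk
      exact (comap_measurable (m := ⊤) _).mono (hle (.left k j) rfl) le_rfl
    · intro j
      exact (comap_measurable (m := ⊤) _).mono (hle (.right k j) rfl) le_rfl
  have hs := @GaltonWatson.measurable_spine Ω (⨆ i ∈ {i : SpineIndex | i.level < n}, spineSigma L R t u i)
    (leftForest L t) (rightForest R u) n
    (fun k hk => (hmeas k _ (fun i hi => by simpa [hi] using hk)).1)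
    (fun k hk => (hmeas k _ (fun i hi => by simpa [hi] using hk)).2)
  have hf := hmeas n {i | i.level = n} (fun i hi => hi)
  have := (Indep_iff _ _ _).1 hI
    {ω | spine (fun k => leftForest L t k ω) (fun k => rightForest R u k ω) n = T}
    {ω | leftForest L t n ω = l ∧ rightForest R u n ω = r}
    (hs (t := {T}) .of_discrete)
    ((hf.1 (t := {l}) .of_discrete).inter (hf.2 (t := {r}) .of_discrete))
  exact this

variable [IsProbabilityMeasure P]

theorem measure_degree (hC : IsSpineConstruction θ P L R t u) (h0 : 0 < θ 0) (h1 : θ 0 < 1)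
    (hm : mean θ ≤ 1) (n i j : ℕ) :
    P {ω | L (n + 1) ω = i ∧ R (n + 1) ω = j} = (growth θ n)⁻¹ * θ (i + j + 1) *
      (extinctMass θ n ^ i * extinctMass θ (n + 1) ^ j) := by
  have h := hC.law_degree n i j
  have hg := (growth_pos θ h0 h1 n).ne'
  have hg' : growth θ n ≠ ∞ := ((growth_le_mean θ n).trans_lt (hm.trans_lt ENNReal.one_lt_top)).ne
  have hh := (ENNReal.toReal_pos (heightMass_pos θ h0 h1 n).ne' (heightMass_ne_top θ n)).ne'
  rw [extinct_succ_sub, extinct_succ_sub, heightMass_succ, extinct_eq, extinct_eq,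
    ENNReal.toReal_mul] at h
  have hR : (growth θ n)⁻¹ * θ (i + j + 1) *
      (extinctMass θ n ^ i * extinctMass θ (n + 1) ^ j) ≠ ∞ :=
    ENNReal.mul_ne_top (ENNReal.mul_ne_top (ENNReal.inv_ne_top.2 hg) (θ.apply_ne_top _))
      (ENNReal.mul_ne_top (ENNReal.pow_ne_top (extinctMass_ne_top θ _))
        (ENNReal.pow_ne_top (extinctMass_ne_top θ _)))
  rw [← ENNReal.toReal_eq_toReal_iff' (measure_ne_top _ _) hR]
  refine h.trans ?_
  have hg2 := (ENNReal.toReal_pos hg hg').ne'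
  simp only [ENNReal.toReal_mul, ENNReal.toReal_inv, ENNReal.toReal_pow]
  field_simp

theorem ae_L_one_eq_zero (hC : IsSpineConstruction θ P L R t u) (h0 : 0 < θ 0) (h1 : θ 0 < 1)
    (hm : mean θ ≤ 1) : ∀ᵐ ω ∂P, L (0 + 1) ω = 0 := by
  have h4 : {ω | ¬ L (0 + 1) ω = 0} ⊆
      ⋃ p : ℕ × ℕ, {ω | L (0 + 1) ω = p.1 + 1 ∧ R (0 + 1) ω = p.2} := by
    intro ω hω
    obtain ⟨a, ha⟩ := Nat.exists_eq_succ_of_ne_zero hω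
    exact Set.mem_iUnion.2 ⟨(a, R (0 + 1) ω), ha, rfl⟩
  refine measure_mono_null h4 (measure_iUnion_null fun p => ?_)
  rw [hC.measure_degree h0 h1 hm, extinctMass_zero]
  simp

open Classical in
/-- The joint law of the forests grafted at a vertex of the spine. -/
theorem measure_forests (hC : IsSpineConstruction θ P L R t u) (h0 : 0 < θ 0) (h1 : θ 0 < 1)
    (hm : mean θ ≤ 1) (n : ℕ) (l r : List PlaneTree) :
    P {ω | leftForest L t n ω = l ∧ rightForest R u n ω = r} =
      if (∀ T ∈ l, T.height < n) ∧ ∀ T ∈ r, T.height < n + 1 then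
        (growth θ n)⁻¹ * θ (l.length + r.length + 1) * (forestWeight θ l * forestWeight θ r)
      else 0 := by
  -- With no left forest possible at s_1, both sides vanish in this case.
  by_cases hl : n = 0 ∧ l ≠ []
  · obtain ⟨rfl, hl⟩ := hl
    have h2 : {ω | leftForest L t 0 ω = l ∧ rightForest R u 0 ω = r} = ∅ := by
      ext ω
      simp [leftForest, hl.symm]
    rw [h2, if_neg, measure_empty]
    rintro ⟨h3, -⟩
    obtain ⟨T, hT⟩ := List.exists_mem_of_ne_nil l hl
    exact absurd (h3 T hT) (by simp)
  have hl' : n = 0 → l.length = 0 := fun hn => by simpa [hn] using hl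
  have hset : P {ω | leftForest L t n ω = l ∧ rightForest R u n ω = r} =
      P {ω | (L (n + 1) ω = l.length ∧ R (n + 1) ω = r.length) ∧
      (∀ k < l.length, t (n + 1) k ω ∈ ({l.getD k (node [])} : Set PlaneTree)) ∧
      ∀ k < r.length, u (n + 1) k ω ∈ ({r.getD k (node [])} : Set PlaneTree)} := by
    by_cases hn : n = 0
    · have hl0 := List.length_eq_zero_iff.1 (hl' hn)
      subst hn hl0
      apply measure_congr
      filter_upwards [hC.ae_L_one_eq_zero h0 h1 hm] with ω hω
      apply propext
      change (leftForest L t 0 ω = [] ∧ rightForest R u 0 ω = r) ↔ (_ ∧ _)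
      rw [rightForest, map_range_eq_iff, leftForest, hω]
      simp
    · congr 1
      ext ω
      simp only [leftForest, hn, if_false, rightForest, map_range_eq_iff, Set.mem_ofPred_eq,
        Set.mem_singleton_iff]
      tauto
  rw [hset, hC.measure_level_inter n _ _ hl', hC.measure_degree h0 h1 hm]
  have e1 : extinctMass θ n ^ l.length *
      ∏ k ∈ Finset.range l.length, P (t (n + 1) k ⁻¹' {l.getD k (node [])}) =
      if ∀ T ∈ l, T.height < n then forestWeight θ l else 0 := by
    rcases n with _ | n
    · have hl0 := List.length_eq_zero_iff.1 (hl' rfl)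
      subst hl0
      simp
    · rw [← pow_mul_prod_treeLaw θ (extinctMass_succ_pos θ h0 h1 n).ne' (extinctMass_ne_top θ _)]
      simp_rw [hC.measure_left]
  have e2 : extinctMass θ (n + 1) ^ r.length *
      ∏ k ∈ Finset.range r.length, P (u (n + 1) k ⁻¹' {r.getD k (node [])}) =
      if ∀ T ∈ r, T.height < n + 1 then forestWeight θ r else 0 := by
    rw [← pow_mul_prod_treeLaw θ (extinctMass_succ_pos θ h0 h1 n).ne' (extinctMass_ne_top θ _)]
    simp_rw [hC.measure_right]
  have e3 : ∀ a b c d f : ℝ≥0∞, a * (b * c) * (d * f) = a * ((b * d) * (c * f)) := by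
    intros; ring
  rw [e3, e1, e2]
  by_cases ha : ∀ T ∈ l, T.height < n <;> by_cases hb : ∀ T ∈ r, T.height < n + 1
  · rw [if_pos ha, if_pos hb, if_pos ⟨ha, hb⟩]
  · rw [if_neg hb, mul_zero, mul_zero]
    exact (if_neg fun h => hb h.2).symm
  · rw [if_neg ha, zero_mul, mul_zero]
    exact (if_neg fun h => ha h.1).symm
  · rw [if_neg ha, zero_mul, mul_zero]
    exact (if_neg fun h => ha h.1).symm

/-- The probability that the trees grafted at a vertex of the spine are lower than given
heights. -/
theorem measure_forests_height_lt (hC : IsSpineConstruction θ P L R t u) (h0 : 0 < θ 0)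
    (h1 : θ 0 < 1) (hm : mean θ ≤ 1) (n a b : ℕ) (ha : a ≤ n) (hb : b ≤ n + 1) :
    P {ω | (∀ T ∈ leftForest L t n ω, T.height < a) ∧
      ∀ T ∈ rightForest R u n ω, T.height < b} =
      (growth θ n)⁻¹ * divDiff θ (extinctMass θ a) (extinctMass θ b) := by
  classical
  have hX := (hC.measurable_forests n).1.prodMk (hC.measurable_forests n).2
  have h := Measure.tsum_indicator_apply_singleton
    (P.map fun ω => (leftForest L t n ω, rightForest R u n ω))
    {p | (∀ T ∈ p.1, T.height < a) ∧ ∀ T ∈ p.2, T.height < b} .of_discrete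
  rw [Measure.map_apply hX .of_discrete] at h
  refine h.symm.trans ?_
  have h3 := tsum_forestWeight_mul θ {T | T.height < a} {T | T.height < b}
    (fun i j => (growth θ n)⁻¹ * θ (i + j + 1))
  simp_rw [mul_assoc (growth θ n)⁻¹, ENNReal.tsum_mul_left] at h3
  rw [divDiff, extinctMass, extinctMass, ← h3, ENNReal.tsum_prod']
  refine tsum_congr fun l => tsum_congr fun r => ?_
  have h4 : (fun ω => (leftForest L t n ω, rightForest R u n ω)) ⁻¹' {(l, r)} =
      {ω | leftForest L t n ω = l ∧ rightForest R u n ω = r} := by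
    ext ω
    simp
  by_cases hlr : (∀ T ∈ l, T.height < a) ∧ ∀ T ∈ r, T.height < b
  · rw [Set.indicator_of_mem (show (l, r) ∈ {p : List PlaneTree × List PlaneTree |
      (∀ T ∈ p.1, T.height < a) ∧ ∀ T ∈ p.2, T.height < b} from hlr)]
    rw [Measure.map_apply hX .of_discrete, h4, hC.measure_forests h0 h1 hm, if_pos ⟨fun T hT => (hlr.1 T hT).trans_le ha,
      fun T hT => (hlr.2 T hT).trans_le hb⟩, mul_assoc]
    exact (if_pos hlr).symm
  · rw [Set.indicator_of_notMem (show (l, r) ∉ {p : List PlaneTree × List PlaneTree |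
      (∀ T ∈ p.1, T.height < a) ∧ ∀ T ∈ p.2, T.height < b} from hlr)]
    exact (if_neg hlr).symm

theorem ae_forests_height_lt (hC : IsSpineConstruction θ P L R t u) (h0 : 0 < θ 0)
    (h1 : θ 0 < 1) (hm : mean θ ≤ 1) :
    ∀ᵐ ω ∂P, ∀ n, (∀ T ∈ leftForest L t n ω, T.height < n) ∧
      ∀ T ∈ rightForest R u n ω, T.height < n + 1 := by
  rw [ae_all_iff]
  intro n
  have hg : growth θ n ≠ ∞ := ((growth_le_mean θ n).trans_lt (hm.trans_lt ENNReal.one_lt_top)).ne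
  have h := hC.measure_forests_height_lt h0 h1 hm n n (n + 1) le_rfl le_rfl
  -- At the extreme bounds n and n+1 the divided difference is `growth θ n` itself, so the event has
  -- full probability.
  rw [← growth, ENNReal.inv_mul_cancel (growth_pos θ h0 h1 n).ne' hg] at h
  refine (prob_compl_eq_zero_iff ?_).2 h
  exact ((hC.measurable_forests n).1.prodMk (hC.measurable_forests n).2)
    (t := {p | (∀ T ∈ p.1, T.height < n) ∧ ∀ T ∈ p.2, T.height < n + 1}) .of_discrete

/-- The tree `d_n` is a Galton-Watson tree conditioned to have height `n`. -/
theorem measure_spine (hC : IsSpineConstruction θ P L R t u) (h0 : 0 < θ 0)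
    (h1 : θ 0 < 1) (hm : mean θ ≤ 1) (n : ℕ) (T : PlaneTree) :
    P {ω | spine (fun k => leftForest L t k ω) (fun k => rightForest R u k ω) n = T} =
      if T.height = n then (heightMass θ n)⁻¹ * weight θ T else 0 := by
  have hae := hC.ae_forests_height_lt h0 h1 hm
  split_ifs with hT
  · induction n generalizing T with
    | zero =>
      rw [height_eq_zero] at hT
      subst hT
      simp [spine, heightMass_zero, weight_node, ENNReal.inv_mul_cancel h0.ne' (θ.apply_ne_top 0)]
    | succ n ih =>
      obtain ⟨ts⟩ := T
      obtain ⟨l, T, r, rfl, hl, hT', hr⟩ := exists_spine_decomposition hT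
      have h2 := hC.measure_spine_and_forests n T l r
      rw [ih T hT', hC.measure_forests h0 h1 hm, if_pos ⟨hl, hr⟩] at h2
      -- By uniqueness of the decomposition, d_{n+1} equals the given tree exactly when d_n and the
      -- two forests equal its three pieces; independence then multiplies the probabilities.
      refine Eq.trans (measure_congr ?_) (h2.trans ?_)
      · filter_upwards [hae] with ω hω
        apply propext
        change spine _ _ (n + 1) = _ ↔ (_ ∧ _ ∧ _)
        rw [spine, node.injEq]
        constructor
        · intro h
          obtain ⟨a, b, c⟩ := spine_decomposition_unique (hω n).1 hl
            (height_spine (fun n => (hω n).1) (fun n => (hω n).2) n) hT' h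
          exact ⟨b, a, c⟩
        · rintro ⟨a, b, c⟩
          rw [a, b, c]
      · have hg' : growth θ n ≠ ∞ :=
          ((growth_le_mean θ n).trans_lt (hm.trans_lt ENNReal.one_lt_top)).ne
        rw [weight_node, forestWeight_append, forestWeight_append, heightMass_succ,
          ENNReal.mul_inv (Or.inl (growth_pos θ h0 h1 n).ne') (Or.inl hg')]
        simp only [List.length_append, List.length_singleton, forestWeight_cons, forestWeight_nil,
          mul_one]
        rw [show l.length + 1 + r.length = l.length + r.length + 1 by ring]
        ring
  · refine measure_mono_null (fun ω hω => ?_) hae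
    intro h
    rw [Set.mem_ofPred_eq] at hω
    apply hT
    rw [← hω]
    exact height_spine (fun n => (h n).1) (fun n => (h n).2) n

theorem map_spine (hC : IsSpineConstruction θ P L R t u) (h0 : 0 < θ 0)
    (h1 : θ 0 < 1) (hm : mean θ ≤ 1) (n : ℕ) :
    P.map (fun ω => spine (fun k => leftForest L t k ω) (fun k => rightForest R u k ω) n) =
      (treeLaw θ)[|{T | T.height = n}] := by
  apply Measure.ext_of_singleton
  intro T
  rw [Measure.map_apply (hC.measurable_spine n) .of_discrete, cond_apply .of_discrete,
    ← heightMass]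
  refine (hC.measure_spine h0 h1 hm n T).trans ?_
  split_ifs with h
  · rw [Set.inter_eq_right.2 (by simpa using h), treeLaw_singleton]
  · rw [Set.inter_singleton_eq_empty.2 (by simpa using h), measure_empty, mul_zero]

theorem ae_spineSubtree_eq (hC : IsSpineConstruction θ P L R t u) (h0 : 0 < θ 0)
    (h1 : θ 0 < 1) (hm : mean θ ≤ 1) :
    ∀ᵐ ω ∂P, spineSubtree (fun r => L r ω) (fun r => R r ω) (fun r j => t r j ω)
      (fun r j => u r j ω) =
      spine (fun k => leftForest L t k ω) (fun k => rightForest R u k ω) := by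
  filter_upwards [hC.ae_L_one_eq_zero h0 h1 hm] with ω hω
  ext n
  rw [spineSubtree_eq_spine]
  congr 1
  ext k
  rw [leftForest]
  split_ifs with hk
  · subst hk
    simp [hω]
  · rfl

end IsSpineConstruction

end GaltonWatson

-- Stabilization of the balls and the local limit

/-- An increment over r steps is a sum of r one-step increments, each of which telescopes to at most
1. -/
theorem ENNReal.tsum_shift_sub_le {a : ℕ → ℝ≥0∞} (ha : Monotone a) (h1 : ∀ n, a n ≤ 1) (r : ℕ) :
    ∑' k, (a (k + r) - a k) ≤ r := by
  induction r with
  | zero => simp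
  | succ r ih =>
    have h : ∀ s, ∑' k, (a (k + s + 1) - a (k + s)) ≤ 1 := by
      intro s
      refine ENNReal.tsum_le_of_sum_range_le fun n => ?_
      have h2 : ∑ k ∈ Finset.range n, (a (k + s + 1) - a (k + s)) + a s = a (n + s) := by
        induction n with
        | zero => simp
        | succ n ih =>
          rw [Finset.sum_range_succ, add_right_comm, ih, add_comm,
            tsub_add_cancel_of_le (ha (Nat.le_succ _)), add_right_comm]
      exact le_self_add.trans (h2.le.trans (h1 _))
    calc ∑' k, (a (k + (r + 1)) - a k)
        ≤ ∑' k, ((a (k + r + 1) - a (k + r)) + (a (k + r) - a k)) :=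
          ENNReal.tsum_le_tsum fun k => tsub_le_tsub_add_tsub
      _ ≤ ((r + 1 : ℕ) : ℝ≥0∞) := by
          rw [ENNReal.tsum_add, Nat.cast_succ, add_comm (r : ℝ≥0∞)]
          exact add_le_add (h r) ih

/-- Monotone convergence for the counting measure. -/
theorem ENNReal.tendsto_tsum_of_monotone {ι : Type*} [Countable ι] {f : ℕ → ι → ℝ≥0∞}
    {F : ι → ℝ≥0∞} (hf : ∀ i, Monotone fun n => f n i)
    (h : ∀ i, Tendsto (fun n => f n i) atTop (𝓝 (F i))) :
    Tendsto (fun n => ∑' i, f n i) atTop (𝓝 (∑' i, F i)) := by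
  let _ : MeasurableSpace ι := ⊤
  have : DiscreteMeasurableSpace ι := ⟨fun _ => trivial⟩
  simp_rw [← lintegral_count]
  exact lintegral_tendsto_of_tendsto_of_monotone (fun n => Measurable.of_discrete.aemeasurable)
    (ae_of_all _ hf) (ae_of_all _ h)

namespace InfiniteReverseTree

theorem measurable_ball (r : ℕ) : Measurable fun τ : InfiniteReverseTree => τ.ball r := by
  have h := le_iSup (fun r : ℕ =>
    MeasurableSpace.comap (fun τ : InfiniteReverseTree => τ.ball r) ⊤) r
  exact measurable_iff_comap_le.2 h

theorem measurable_of_ball {Ω : Type*} [MeasurableSpace Ω] {τ : Ω → InfiniteReverseTree}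
    (h : ∀ r, Measurable fun ω => (τ ω).ball r) : Measurable τ := by
  rw [measurable_iff_comap_le]
  change MeasurableSpace.comap τ (⨆ r : ℕ, _) ≤ _
  rw [MeasurableSpace.comap_iSup]
  refine iSup_le fun r => ?_
  rw [MeasurableSpace.comap_comp]
  exact (h r).comap_le

end InfiniteReverseTree

namespace GaltonWatson

namespace IsSpineConstruction

variable {θ : PMF ℕ} {Ω : Type*} [mΩ : MeasurableSpace Ω] {P : Measure Ω} [IsProbabilityMeasure P]
  {L R : ℕ → Ω → ℕ} {t u : ℕ → ℕ → Ω → PlaneTree}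

/-- Almost surely, only finitely many of the grafted trees reach a given reverse height. -/
theorem ae_eventually_height_lt (hC : IsSpineConstruction θ P L R t u) (h0 : 0 < θ 0)
    (h1 : θ 0 < 1) (hm : mean θ ≤ 1) : ∀ᵐ ω ∂P, ∀ r : ℕ, ∀ᶠ n in atTop,
      ∀ T ∈ leftForest L t n ω ++ rightForest R u n ω, T.height < n - r := by
  rw [ae_all_iff]
  intro r
  have hg' : ∀ n, growth θ n ≠ ∞ := fun n =>
    ((growth_le_mean θ n).trans_lt (hm.trans_lt ENNReal.one_lt_top)).ne
  have hg : ∀ n, growth θ n ≠ 0 := fun n => (growth_pos θ h0 h1 n).ne'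
  -- With n = k + (r + 1), the bound k + 1 is n - r, so the complement says that some tree grafted
  -- at level n reaches height n - r.
  let E : ℕ → Set Ω := fun k => {ω | (∀ T ∈ leftForest L t (k + (r + 1)) ω, T.height < k + 1) ∧
    ∀ T ∈ rightForest R u (k + (r + 1)) ω, T.height < k + 1}
  have hE : ∀ k, MeasurableSet (E k) := fun k =>
    ((hC.measurable_forests (k + (r + 1))).1.prodMk (hC.measurable_forests (k + (r + 1))).2)
      (t := {p | (∀ T ∈ p.1, T.height < k + 1) ∧ ∀ T ∈ p.2, T.height < k + 1}) .of_discrete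
  -- The complement has probability 1 - D(q_{k+1}, q_{k+1}) / `growth` at level k + r + 1; bound D
  -- below by `growth θ k` and the denominator by `growth θ 0`.
  have hP : ∀ k, P (E k)ᶜ ≤ (growth θ 0)⁻¹ * (growth θ (k + (r + 1)) - growth θ k) := by
    intro k
    rw [prob_compl_eq_one_sub (hE k),
      hC.measure_forests_height_lt h0 h1 hm _ (k + 1) (k + 1) (by omega) (by omega),
      ← ENNReal.inv_mul_cancel (hg (k + (r + 1))) (hg' _),
      ← ENNReal.mul_sub (fun _ _ => ENNReal.inv_ne_top.2 (hg _))]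
    refine mul_le_mul' (ENNReal.inv_le_inv.2 (growth_mono θ (Nat.zero_le _)))
      (tsub_le_tsub_left ?_ _)
    exact divDiff_mono θ (extinctMass_mono θ (Nat.le_succ k)) le_rfl
  have hs : ∑' k, P (E k)ᶜ ≠ ∞ := by
    refine ne_top_of_le_ne_top ?_ (ENNReal.tsum_le_tsum hP)
    rw [ENNReal.tsum_mul_left]
    exact ENNReal.mul_ne_top (ENNReal.inv_ne_top.2 (hg 0)) (ne_top_of_le_ne_top
      (ENNReal.natCast_ne_top (r + 1)) (ENNReal.tsum_shift_sub_le (growth_mono θ)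
        (fun n => (growth_le_mean θ n).trans hm) (r + 1)))
  filter_upwards [ae_eventually_notMem hs] with ω hω
  obtain ⟨N, hN⟩ := eventually_atTop.1 hω
  refine eventually_atTop.2 ⟨N + (r + 1), fun n hn T hT => ?_⟩
  have h2 := Set.notMem_compl_iff.1 (hN (n - (r + 1)) (by omega))
  simp only [E, Set.mem_ofPred_eq, show n - (r + 1) + (r + 1) = n by omega] at h2
  rcases List.mem_append.1 hT with hT | hT
  · have := h2.1 T hT
    omega
  · have := h2.2 T hT
    omega

/-- The infinite reverse tree obtained from the spine construction. -/
theorem exists_limit (hC : IsSpineConstruction θ P L R t u) (h0 : 0 < θ 0)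
    (h1 : θ 0 < 1) (hm : mean θ ≤ 1) : ∃ τ : Ω → InfiniteReverseTree, Measurable τ ∧
      ∀ᵐ ω ∂P, ∀ r, ∀ᶠ n : ℕ in atTop, descend (n - r)
        [spine (fun k => leftForest L t k ω) (fun k => rightForest R u k ω) n] = (τ ω).ball r := by
  classical
  let d : ℕ → Ω → PlaneTree := fun n ω =>
    spine (fun k => leftForest L t k ω) (fun k => rightForest R u k ω) n
  have hd : ∀ r n : ℕ, Measurable fun ω => descend (n - r) [d n ω] := fun r n =>
    (Measurable.of_discrete (f := fun T => descend (n - r) [T])).comp (hC.measurable_spine n)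
  -- A measurable event of full probability on which convergence holds everywhere; the default tree
  -- is used outside it, so that the limit is measurable and not only almost everywhere defined.
  let G : Set Ω := ((⋂ n, {ω | (∀ T ∈ leftForest L t n ω, T.height < n) ∧
      ∀ T ∈ rightForest R u n ω, T.height < n + 1})) ∩
    ⋂ r, ⋃ N, ⋂ n, ⋂ (_ : N ≤ n), {ω | ∀ T ∈ leftForest L t n ω ++ rightForest R u n ω, T.height < n - r}
  have hpair : ∀ n, Measurable fun ω => (leftForest L t n ω, rightForest R u n ω) :=
    fun n => (hC.measurable_forests n).1.prodMk (hC.measurable_forests n).2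
  have hG : MeasurableSet G := by
    refine (MeasurableSet.iInter fun n => ?_).inter (MeasurableSet.iInter fun r =>
      MeasurableSet.iUnion fun N => MeasurableSet.iInter fun n => MeasurableSet.iInter fun _ => ?_)
    · exact hpair n (t := {p | (∀ T ∈ p.1, T.height < n) ∧ ∀ T ∈ p.2, T.height < n + 1})
        .of_discrete
    · exact hpair n (t := {p | ∀ T ∈ p.1 ++ p.2, T.height < n - r}) .of_discrete
  have hGlim : ∀ ω ∈ G, ∃ τ : InfiniteReverseTree, ∀ r, ∀ᶠ n : ℕ in atTop,
      descend (n - r) [d n ω] = τ.ball r := by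
    rintro ω ⟨h2, h3⟩
    have h2 := Set.mem_iInter.1 h2
    refine exists_infiniteReverseTree (fun n => (h2 n).1) (fun n => (h2 n).2) fun r => ?_
    obtain ⟨N, hN⟩ := Set.mem_iUnion.1 (Set.mem_iInter.1 h3 r)
    refine eventually_atTop.2 ⟨N, fun n hn => ?_⟩
    exact Set.mem_iInter.1 (Set.mem_iInter.1 hN n) hn
  let τ : Ω → InfiniteReverseTree := fun ω =>
    if h : ω ∈ G then (hGlim ω h).choose else Classical.arbitrary _
  have hτ : ∀ ω ∈ G, ∀ r, ∀ᶠ n : ℕ in atTop, descend (n - r) [d n ω] = (τ ω).ball r := by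
    intro ω hω
    simp only [τ, hω, dif_pos]
    exact (hGlim ω hω).choose_spec
  refine ⟨τ, InfiniteReverseTree.measurable_of_ball fun r => ?_, ?_⟩
  · refine measurable_to_countable' fun f => ?_
    have : (fun ω => (τ ω).ball r) ⁻¹' {f} =
        (G ∩ ⋃ N, ⋂ n, ⋂ (_ : N ≤ n), (fun ω => descend (n - r) [d n ω]) ⁻¹' {f}) ∪
        (Gᶜ ∩ {_ω | (Classical.arbitrary InfiniteReverseTree).ball r = f}) := by
      ext ω
      by_cases hω : ω ∈ G
      · have h2 := hτ ω hω r
        simp only [Set.mem_preimage, Set.mem_singleton_iff, Set.mem_union, Set.mem_inter_iff, hω,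
          true_and, Set.mem_iUnion, Set.mem_iInter, Set.mem_compl_iff, not_true_eq_false, false_and,
          or_false, ← eventually_atTop (p := fun n => descend (n - r) [d n ω] = f)]
        constructor
        · rintro rfl
          exact h2
        · intro h3
          obtain ⟨n, h4, h5⟩ := (h2.and h3).exists
          rw [← h4, h5]
      · simp [τ, hω]
    rw [this]
    refine (hG.inter (MeasurableSet.iUnion fun N => MeasurableSet.iInter fun n =>
      MeasurableSet.iInter fun _ => hd r n .of_discrete)).union (hG.compl.inter ?_)
    exact MeasurableSet.const _
  · filter_upwards [hC.ae_forests_height_lt h0 h1 hm, hC.ae_eventually_height_lt h0 h1 hm]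
      with ω h2 h3
    refine hτ ω ⟨Set.mem_iInter.2 h2, Set.mem_iInter.2 fun r => ?_⟩
    obtain ⟨N, hN⟩ := eventually_atTop.1 (h3 r)
    exact Set.mem_iUnion.2 ⟨N, Set.mem_iInter.2 fun n => Set.mem_iInter.2 fun hn => hN n hn⟩

/-- The law of the tree obtained from a spine is the local limit of Galton-Watson trees
conditioned on their height. -/
theorem tendsto_cond_height (hC : IsSpineConstruction θ P L R t u) (h0 : 0 < θ 0)
    (h1 : θ 0 < 1) (hm : mean θ ≤ 1) {τ : Ω → InfiniteReverseTree} (hτ : Measurable τ)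
    (hlim : ∀ᵐ ω ∂P, ∀ r, ∀ᶠ n : ℕ in atTop, descend (n - r)
      [spine (fun k => leftForest L t k ω) (fun k => rightForest R u k ω) n] = (τ ω).ball r)
    (r : ℕ) (A : Set (List PlaneTree)) :
    Tendsto (fun n : ℕ => ((treeLaw θ)[|{T | T.height = n}]).real {T | descend (n - r) [T] ∈ A})
      atTop (𝓝 (P.real {ω | (τ ω).ball r ∈ A})) := by
  have hd : ∀ n : ℕ, MeasurableSet {ω | descend (n - r)
      [spine (fun k => leftForest L t k ω) (fun k => rightForest R u k ω) n] ∈ A} := fun n => by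
    exact (hC.measurable_spine n) (t := {T | descend (n - r) [T] ∈ A}) .of_discrete
  -- Each ball is eventually constant almost surely, so the indicators converge and so do the
  -- probabilities, for arbitrary A.
  have h := tendsto_measure_of_ae_tendsto_indicator_of_isFiniteMeasure (μ := P) (L := atTop)
    (A := {ω | (τ ω).ball r ∈ A})
    ((InfiniteReverseTree.measurable_ball r).comp hτ (t := A) .of_discrete) hd (by
      filter_upwards [hlim] with ω hω
      filter_upwards [hω r] with n hn
      simp only [hn])
  refine ((ENNReal.tendsto_toReal (measure_ne_top P _)).comp h).congr fun n => ?_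
  rw [← hC.map_spine h0 h1 hm, Measure.real, Measure.map_apply (hC.measurable_spine n) .of_discrete]
  rfl

end IsSpineConstruction

-- Asymptotics of the height probabilities

/-- The limit e is a fixed point of g. If e < 1, then D(e,1) = 1, whereas D(1,1) = m ≤ 1. Some θ(k)
> 0 with k ≥ 2 would make D(e,1) < D(1,1); otherwise D(e,1) = θ(1) = 1, against θ(0) > 0. -/
theorem tendsto_extinctMass (θ : PMF ℕ) (h0 : 0 < θ 0) (hm : mean θ ≤ 1) :
    Tendsto (extinctMass θ) atTop (𝓝 1) := by
  have hlim := tendsto_atTop_iSup (extinctMass_mono θ)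
  set e := ⨆ n, extinctMass θ n with he
  have hle : e ≤ 1 := iSup_le (extinctMass_le_one θ)
  have hfix : pgf θ e = e := by
    refine tendsto_nhds_unique (f := fun n => extinctMass θ (n + 1)) (l := atTop) ?_
      ((tendsto_add_atTop_iff_nat 1).2 hlim)
    simp_rw [extinctMass_succ]
    refine ENNReal.tendsto_tsum_of_monotone (fun k i j hij => ?_) fun k => ?_
    · have := extinctMass_mono θ hij
      dsimp only
      gcongr
    · exact ENNReal.Tendsto.const_mul (ENNReal.Tendsto.pow hlim) (Or.inr (θ.apply_ne_top k))
  suffices e = 1 by rwa [this] at hlim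
  by_contra hne
  have hlt : e < 1 := lt_of_le_of_ne hle hne
  have hone : pgf θ 1 = 1 := by simp [pgf, θ.tsum_coe]
  have hadd : e + (1 - e) = 1 := add_tsub_cancel_of_le hle
  have h2 := pgf_add θ e (1 - e)
  rw [hadd, hone, hfix] at h2
  have h3 : divDiff θ e 1 = 1 := by
    have h4 : divDiff θ e 1 * (1 - e) = 1 * (1 - e) := by
      rw [one_mul, ← ENNReal.add_right_inj (hlt.trans ENNReal.one_lt_top).ne, ← h2, hadd]
    exact (ENNReal.mul_left_inj (tsub_pos_of_lt hlt).ne'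
      (ne_top_of_le_ne_top ENNReal.one_ne_top tsub_le_self)).1 h4
  rw [divDiff, ENNReal.tsum_nat_prod_eq_antidiagonal] at h3
  have h5 : ∑' k, ∑ i ∈ Finset.range (k + 1), θ (i + (k - i) + 1) * (1 ^ i * 1 ^ (k - i)) ≤ 1 := by
    rwa [← ENNReal.tsum_nat_prod_eq_antidiagonal (fun i j => θ (i + j + 1) * (1 ^ i * 1 ^ j)),
      ← divDiff, divDiff_one_one]
  have h6 : ∀ k, ∑ i ∈ Finset.range (k + 1), θ (i + (k - i) + 1) * (e ^ i * 1 ^ (k - i)) ≤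
      ∑ i ∈ Finset.range (k + 1), θ (i + (k - i) + 1) * (1 ^ i * 1 ^ (k - i)) := by
    intro k
    gcongr
  by_cases h7 : ∃ k, θ (k + 2) ≠ 0
  · obtain ⟨k, hk⟩ := h7
    refine absurd h3 (ne_of_lt ((ENNReal.tsum_lt_tsum (i := k + 1) (by rw [h3]; simp) h6 ?_).trans_le
      h5))
    -- Isolates the linear term, where e < 1 gives the strict inequality.
    have hc : ∀ x : ℝ≥0∞, ∑ i ∈ Finset.range (k + 1 + 1),
        θ (i + (k + 1 - i) + 1) * (x ^ i * 1 ^ (k + 1 - i)) =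
        θ (k + 2) * ((∑ i ∈ Finset.range k, x ^ (i + 2)) + x + 1) := by
      intro x
      rw [Finset.sum_congr rfl (g := fun i => θ (k + 2) * x ^ i), ← Finset.mul_sum,
        Finset.sum_range_succ', Finset.sum_range_succ']
      · simp
      · intro i hi
        have : i ≤ k + 1 := Nat.lt_succ_iff.1 (Finset.mem_range.1 hi)
        rw [show i + (k + 1 - i) + 1 = k + 2 by omega, one_pow, mul_one]
    rw [hc, hc]
    refine (ENNReal.mul_lt_mul_iff_right hk (θ.apply_ne_top _)).2 ?_
    refine ENNReal.add_lt_add_right ENNReal.one_ne_top ?_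
    refine ENNReal.add_lt_add_of_le_of_lt ?_ ?_ hlt
    · refine ENNReal.sum_ne_top.2 fun i _ => ENNReal.pow_ne_top (hlt.trans ENNReal.one_lt_top).ne
    · gcongr
  · push Not at h7
    rw [tsum_eq_single 0] at h3
    · have h8 : θ 0 + θ 1 ≤ 1 := by
        rw [← θ.tsum_coe, ← Finset.sum_range_one (fun k => θ k), ← Finset.sum_range_succ]
        exact ENNReal.sum_le_tsum _
      simp only [zero_add, Finset.range_one, Finset.sum_singleton, tsub_zero, pow_zero, mul_one,
        add_zero] at h3
      rw [h3] at h8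
      have : (1 : ℝ≥0∞) < θ 0 + 1 := by
        rw [add_comm]
        exact ENNReal.lt_add_right ENNReal.one_ne_top h0.ne'
      exact absurd h8 (not_le.2 this)
    · intro k hk
      obtain ⟨k, rfl⟩ := Nat.exists_eq_succ_of_ne_zero hk
      refine Finset.sum_eq_zero fun i hi => ?_
      have : i ≤ k + 1 := Nat.lt_succ_iff.1 (Finset.mem_range.1 hi)
      rw [show i + (k + 1 - i) + 1 = k + 2 by omega, h7, zero_mul]

theorem tendsto_growth (θ : PMF ℕ) (h0 : 0 < θ 0) (hm : mean θ ≤ 1) :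
    Tendsto (growth θ) atTop (𝓝 (mean θ)) := by
  have he := tendsto_extinctMass θ h0 hm
  have he' := (tendsto_add_atTop_iff_nat 1).2 he
  rw [← divDiff_one_one]
  have h2 : ∀ x y, divDiff θ x y = ∑' p : ℕ × ℕ, θ (p.1 + p.2 + 1) * (x ^ p.1 * y ^ p.2) :=
    fun x y => (ENNReal.tsum_prod (f := fun i j => θ (i + j + 1) * (x ^ i * y ^ j))).symm
  unfold growth
  simp_rw [h2]
  refine ENNReal.tendsto_tsum_of_monotone (fun p i j hij => ?_) fun p => ?_
  · have h3 := extinctMass_mono θ hij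
    have h4 := extinctMass_mono θ (Nat.add_le_add_right hij 1)
    dsimp only
    gcongr
  · refine ENNReal.Tendsto.const_mul (ENNReal.Tendsto.mul (ENNReal.Tendsto.pow he) ?_
      (ENNReal.Tendsto.pow he') ?_) (Or.inr (θ.apply_ne_top _)) <;> simp

theorem tendsto_heightMass_ratio (θ : PMF ℕ) (h0 : 0 < θ 0) (h1 : θ 0 < 1) (hm : mean θ ≤ 1)
    (r : ℕ) : Tendsto (fun n => (heightMass θ (n + r)).toReal / (heightMass θ n).toReal) atTop
      (𝓝 ((mean θ).toReal ^ r)) := by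
  have hh : ∀ n, (heightMass θ n).toReal ≠ 0 := fun n =>
    (ENNReal.toReal_pos (heightMass_pos θ h0 h1 n).ne' (heightMass_ne_top θ n)).ne'
  induction r with
  | zero => simp [hh]
  | succ r ih =>
    have h2 := (ENNReal.tendsto_toReal (ne_top_of_le_ne_top ENNReal.one_ne_top hm)).comp
      (tendsto_growth θ h0 hm)
    have h3 := (h2.comp (tendsto_add_atTop_nat r)).mul ih
    rw [pow_succ']
    refine h3.congr fun n => ?_
    rw [← add_assoc, heightMass_succ, ENNReal.toReal_mul]
    simp only [Function.comp_apply]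
    ring

end GaltonWatson

-- Laws on infinite reverse trees are determined by their balls

namespace InfiniteReverseTree

/-- A ball determines all smaller ones, so two events {B_r = f} either are disjoint or intersect in
one of them. Events with f empty or of the wrong height are empty. -/
theorem ext_of_ball {ν ν' : Measure InfiniteReverseTree} [IsProbabilityMeasure ν]
    [IsProbabilityMeasure ν'] (h : ∀ (r : ℕ) (f : List PlaneTree), f ≠ [] → forestHeight f = r →
      ν.real {τ | τ.ball r = f} = ν'.real {τ | τ.ball r = f}) : ν = ν' := by
  let C : Set (Set InfiniteReverseTree) := {S | ∃ r f, S = {τ | τ.ball r = f}}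
  refine ext_of_generate_finite C ?_ ?_ ?_ (by simp)
  · apply le_antisymm
    · refine iSup_le fun r => ?_
      rintro _ ⟨S, -, rfl⟩
      have : (fun τ : InfiniteReverseTree => τ.ball r) ⁻¹' S =
          ⋃ f ∈ S, {τ : InfiniteReverseTree | τ.ball r = f} := by
        ext τ
        simp
      rw [this]
      exact MeasurableSet.biUnion S.to_countable fun f _ =>
        MeasurableSpace.measurableSet_generateFrom ⟨r, f, rfl⟩
    · refine MeasurableSpace.generateFrom_le ?_
      rintro _ ⟨r, f, rfl⟩
      exact measurable_ball r (t := {f}) .of_discrete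
  · have key : ∀ (r s : ℕ) (f g : List PlaneTree), r ≤ s →
        ({τ | τ.ball r = f} ∩ {τ | τ.ball s = g} : Set InfiniteReverseTree).Nonempty →
        ({τ | τ.ball r = f} ∩ {τ | τ.ball s = g} : Set InfiniteReverseTree) ∈ C := by
      rintro r s f g hrs ⟨τ, rfl, rfl⟩
      refine ⟨s, τ.ball s, Set.inter_eq_right.2 fun τ' hτ' => ?_⟩
      have h1 := τ'.ball_consistent r s hrs
      rw [show τ'.ball s = τ.ball s from hτ', τ.ball_consistent r s hrs] at h1
      exact h1.symm
    rintro _ ⟨r, f, rfl⟩ _ ⟨s, g, rfl⟩ hne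
    rcases le_total r s with hrs | hrs
    · exact key r s f g hrs hne
    · rw [Set.inter_comm] at hne ⊢
      exact key s r g f hrs hne
  · rintro _ ⟨r, f, rfl⟩
    by_cases hf : f ≠ [] ∧ forestHeight f = r
    · exact (ENNReal.toReal_eq_toReal_iff' (measure_ne_top _ _) (measure_ne_top _ _)).1
        (h r f hf.1 hf.2)
    · have : {τ : InfiniteReverseTree | τ.ball r = f} = ∅ := by
        rw [Set.eq_empty_iff_forall_notMem]
        rintro τ rfl
        exact hf ⟨τ.ball_ne_nil r, τ.height_ball r⟩
      simp [this]

theorem length_descend_ball (τ : InfiniteReverseTree) (r : ℕ) :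
    (descend r (τ.ball r)).length = (τ.ball 0).length := by
  rw [← τ.ball_consistent 0 r (Nat.zero_le r), Nat.sub_zero]

end InfiniteReverseTree

theorem PlaneTree.eq_replicate_of_forestHeight_eq_zero {f : List PlaneTree} (hf : f ≠ [])
    (h : forestHeight f = 0) : f = List.replicate f.length (node []) := by
  have h2 := (forestHeight_lt hf (n := 1)).1 (by omega)
  exact List.eq_replicate_iff.2 ⟨rfl, fun t ht => height_eq_zero.1 (by have := h2 t ht; omega)⟩

theorem PlaneTree.forestHeight_replicate (p : ℕ) :
    forestHeight (List.replicate (p + 1) (node [])) = 0 := by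
  have := (forestHeight_lt (f := List.replicate (p + 1) (node [])) (n := 1) (by simp)).2 (by
    intro t ht
    rw [List.eq_of_mem_replicate ht, height_eq_zero.2 rfl]
    exact Nat.one_pos)
  omega

-- The quasi-stationary measure and the laws of the balls

namespace GaltonWatson

theorem forestWeight_replicate (θ : PMF ℕ) (p : ℕ) :
    forestWeight θ (List.replicate p (node [])) = θ 0 ^ p := by
  induction p with
  | zero => simp
  | succ p ih => simp [List.replicate_succ, ih, weight_node, pow_succ']

theorem pow_le_sumLaw_zero (θ : PMF ℕ) (k : ℕ) : θ 0 ^ k ≤ sumLaw θ k 0 := by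
  induction k with
  | zero => simp [sumLaw]
  | succ k ih =>
    rw [sumLaw, PMF.bind_apply, pow_succ']
    refine le_trans ?_ (ENNReal.le_tsum 0)
    refine mul_le_mul' le_rfl (ih.trans ?_)
    rw [PMF.map_apply]
    refine le_trans ?_ (ENNReal.le_tsum 0)
    simp

theorem mul_pow_le_sumLaw_one (θ : PMF ℕ) (k : ℕ) : θ 1 * θ 0 ^ k ≤ sumLaw θ (k + 1) 1 := by
  rw [sumLaw, PMF.bind_apply]
  refine le_trans ?_ (ENNReal.le_tsum 1)
  refine mul_le_mul' le_rfl ((pow_le_sumLaw_zero θ k).trans ?_)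
  rw [PMF.map_apply]
  refine le_trans ?_ (ENNReal.le_tsum 0)
  simp

theorem heightMass_le_tsum (θ : PMF ℕ) (n : ℕ) :
    heightMass θ n ≤ ∑' k, processLaw θ n (k + 1) * θ 0 ^ (k + 1) := by
  have h : {T : PlaneTree | T.height = n} ⊆
      ⋃ k : ℕ, {T | descend n [T] = List.replicate (k + 1) (node [])} := by
    intro T hT
    obtain ⟨h1, h2⟩ := height_eq_iff.1 hT
    rw [add_comm, descend_add] at h2
    have h3 := eq_replicate_of_forestHeight_eq_zero h1 ((forestHeight_eq_iff h1).2 ⟨h1, h2⟩)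
    obtain ⟨k, hk⟩ := Nat.exists_eq_succ_of_ne_zero (mt List.length_eq_zero_iff.1 h1)
    rw [hk] at h3
    exact Set.mem_iUnion.2 ⟨k, h3⟩
  refine (measure_mono h).trans ((measure_iUnion_le _).trans (ENNReal.tsum_le_tsum fun k => ?_))
  rw [treeLaw_descend, forestWeight_replicate, List.length_replicate]

/-- In a tree of height n, let one vertex of generation n have a single child instead of none: this
contributes to X(n+1) = 1, and replaces a factor θ(0) by θ(1). -/
theorem heightMass_mul_le (θ : PMF ℕ) (n : ℕ) :
    θ 1 * heightMass θ n ≤ processLaw θ (n + 1) 1 * θ 0 := by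
  rw [processLaw, PMF.bind_apply]
  calc θ 1 * heightMass θ n ≤ θ 1 * ∑' k, processLaw θ n (k + 1) * θ 0 ^ (k + 1) :=
        mul_le_mul' le_rfl (heightMass_le_tsum θ n)
    _ = (∑' k, processLaw θ n (k + 1) * (θ 1 * θ 0 ^ k)) * θ 0 := by
        rw [← ENNReal.tsum_mul_left, ← ENNReal.tsum_mul_right]
        refine tsum_congr fun k => ?_
        ring
    _ ≤ (∑' k, processLaw θ n (k + 1) * sumLaw θ (k + 1) 1) * θ 0 := by
        gcongr with k
        exact mul_pow_le_sumLaw_one θ k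
    _ ≤ _ := by
        exact mul_le_mul' (ENNReal.tsum_comp_le_tsum_of_injective Nat.succ_injective
          (fun k => processLaw θ n k * sumLaw θ k 1)) le_rfl

theorem cond_height_descend (θ : PMF ℕ) (n : ℕ) {r : ℕ} {f : List PlaneTree} (hf : f ≠ [])
    (hr : forestHeight f = r) :
    ((treeLaw θ)[|{T | T.height = n + r}]).real {T | descend (n + r - r) [T] ∈ ({f} : Set _)} =
      (processLaw θ n f.length).toReal * (forestWeight θ f).toReal /
        (heightMass θ (n + r)).toReal := by
  rw [Measure.real, cond_apply .of_discrete, ← heightMass, Nat.add_sub_cancel]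
  have : {T : PlaneTree | T.height = n + r} ∩ {T | descend n [T] ∈ ({f} : Set _)} =
      {T | descend n [T] = f} := by
    ext T
    simp only [Set.mem_inter_iff, Set.mem_ofPred_eq, Set.mem_singleton_iff, and_iff_right_iff_imp]
    intro h
    rw [height_of_descend_eq hf hr h, add_comm]
  rw [this, treeLaw_descend, ENNReal.toReal_mul, ENNReal.toReal_mul, ENNReal.toReal_inv]
  ring

section LocalLimit

/-- The measure `ν` is the local limit, seen from the last generation, of the laws of
Galton-Watson trees conditioned on their height. -/
def IsLocalLimit (θ : PMF ℕ) (ν : Measure InfiniteReverseTree) : Prop :=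
  ∀ (r : ℕ) (A : Set (List PlaneTree)), Tendsto (fun n : ℕ =>
    ((treeLaw θ)[|{T | T.height = n}]).real {T | descend (n - r) [T] ∈ A}) atTop
    (𝓝 (ν.real {τ | τ.ball r ∈ A}))

variable {θ : PMF ℕ} {ν : Measure InfiniteReverseTree}

theorem tendsto_ball (hν : IsLocalLimit θ ν) {r : ℕ} {f : List PlaneTree} (hf : f ≠ [])
    (hr : forestHeight f = r) :
    Tendsto (fun n => (processLaw θ n f.length).toReal * (forestWeight θ f).toReal /
        (heightMass θ (n + r)).toReal) atTop (𝓝 (ν.real {τ | τ.ball r = f})) :=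
  ((hν r {f}).comp (tendsto_add_atTop_nat r)).congr fun n => cond_height_descend θ n hf hr

theorem tendsto_ball_zero (hν : IsLocalLimit θ ν) (h0 : 0 < θ 0) (p : ℕ) :
    Tendsto (fun n => (processLaw θ n (p + 1)).toReal / (heightMass θ n).toReal) atTop
      (𝓝 (ν.real {τ | τ.ball 0 = List.replicate (p + 1) (node [])} / (θ 0).toReal ^ (p + 1))) := by
  have ht := (ENNReal.toReal_pos h0.ne' (θ.apply_ne_top 0)).ne'
  have h := (tendsto_ball hν (r := 0) (f := List.replicate (p + 1) (node [])) (by simp)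
    (forestHeight_replicate p)).div_const ((θ 0).toReal ^ (p + 1))
  refine h.congr fun n => ?_
  rw [forestWeight_replicate, List.length_replicate, ENNReal.toReal_pow, add_zero]
  field_simp

/-- Since h_{n+1} ≤ h_n, `heightMass_mul_le` bounds the conditional probabilities below by θ(1)
uniformly in n, and the bound passes to the limit. -/
theorem ball_zero_one_pos (hν : IsLocalLimit θ ν) (h0 : 0 < θ 0) (h1 : θ 0 < 1) (hm : mean θ ≤ 1)
    (hθ : 0 < θ 1) : 0 < ν.real {τ | τ.ball 0 = [node []]} := by
  have hpos := ENNReal.toReal_pos hθ.ne' (θ.apply_ne_top 1)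
  refine hpos.trans_le ?_
  have h := tendsto_ball hν (r := 0) (f := List.replicate 1 (node [])) (by simp)
    (forestHeight_replicate 0)
  refine ge_of_tendsto ((tendsto_add_atTop_iff_nat 1).2 h) (Eventually.of_forall fun n => ?_)
  have hh := ENNReal.toReal_pos (heightMass_pos θ h0 h1 (n + 1)).ne' (heightMass_ne_top θ (n + 1))
  rw [forestWeight_replicate, List.length_replicate, add_zero, pow_one, le_div_iff₀ hh,
    ← ENNReal.toReal_mul, ← ENNReal.toReal_mul]
  refine ENNReal.toReal_mono (ENNReal.mul_ne_top (PMF.apply_ne_top _ _) (θ.apply_ne_top 0))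
    (le_trans (mul_le_mul' le_rfl ?_) (heightMass_mul_le θ n))
  rw [heightMass_succ]
  exact mul_le_of_le_one_left' ((growth_le_mean θ n).trans hm)

/-- Quotient of two limits of P(X(n) = ·)/h_n, in which h_n cancels; the positivity of the limit for
one vertex is what allows the division. -/
theorem tendsto_ratio (hν : IsLocalLimit θ ν) (h0 : 0 < θ 0) (h1 : θ 0 < 1) (hm : mean θ ≤ 1)
    (hθ : 0 < θ 1) (p : ℕ) : Tendsto (ratio θ (p + 1)) atTop
      (𝓝 (ν.real {τ | τ.ball 0 = List.replicate (p + 1) (node [])} / (θ 0).toReal ^ (p + 1) /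
        (ν.real {τ | τ.ball 0 = [node []]} / (θ 0).toReal))) := by
  have ht := (ENNReal.toReal_pos h0.ne' (θ.apply_ne_top 0)).ne'
  have hb := (ball_zero_one_pos hν h0 h1 hm hθ).ne'
  have h := (tendsto_ball_zero hν h0 p).div (tendsto_ball_zero hν h0 0)
    (by simpa using ⟨hb, ht⟩)
  simp only [zero_add, pow_one, List.replicate_one] at h
  refine h.congr fun n => ?_
  have hh := (ENNReal.toReal_pos (heightMass_pos θ h0 h1 n).ne' (heightMass_ne_top θ n)).ne'
  exact div_div_div_cancel_right₀ hh _ _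

theorem quasiStat_succ (hν : IsLocalLimit θ ν) (h0 : 0 < θ 0) (h1 : θ 0 < 1) (hm : mean θ ≤ 1)
    (hθ : 0 < θ 1) (p : ℕ) : quasiStat θ (p + 1) =
      ν.real {τ | τ.ball 0 = List.replicate (p + 1) (node [])} / (θ 0).toReal ^ (p + 1) /
        (ν.real {τ | τ.ball 0 = [node []]} / (θ 0).toReal) :=
  (tendsto_ratio hν h0 h1 hm hθ p).limUnder_eq

theorem hasSum_ball_zero (ν : Measure InfiniteReverseTree) [IsProbabilityMeasure ν] :
    HasSum (fun p : ℕ => ν.real {τ | τ.ball 0 = List.replicate (p + 1) (node [])}) 1 := by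
  have hU : (⋃ p : ℕ, {τ : InfiniteReverseTree | τ.ball 0 = List.replicate (p + 1) (node [])}) =
      Set.univ := by
    rw [Set.eq_univ_iff_forall]
    intro τ
    have h3 := eq_replicate_of_forestHeight_eq_zero (τ.ball_ne_nil 0) (τ.height_ball 0)
    obtain ⟨k, hk⟩ := Nat.exists_eq_succ_of_ne_zero
      (mt List.length_eq_zero_iff.1 (τ.ball_ne_nil 0))
    rw [hk] at h3
    exact Set.mem_iUnion.2 ⟨k, h3⟩
  have h := measure_iUnion (μ := ν)
    (f := fun p : ℕ => {τ : InfiniteReverseTree | τ.ball 0 = List.replicate (p + 1) (node [])})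
    (by
      intro p q hpq
      rw [Function.onFun, Set.disjoint_left]
      intro τ h h'
      have h2 := h.symm.trans h'
      exact hpq (by simpa using congrArg List.length h2))
    (fun p => InfiniteReverseTree.measurable_ball 0
      (t := {List.replicate (p + 1) (node [])}) .of_discrete)
  rw [hU, measure_univ] at h
  have h2 := ENNReal.hasSum_toReal (h.symm ▸ ENNReal.one_ne_top)
  rw [← ENNReal.tsum_toReal_eq (fun p => measure_ne_top ν _), ← h, ENNReal.toReal_one] at h2
  exact h2

theorem quasiStat_one (hν : IsLocalLimit θ ν) (h0 : 0 < θ 0) (h1 : θ 0 < 1) (hm : mean θ ≤ 1)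
    (hθ : 0 < θ 1) : quasiStat θ 1 = 1 := by
  have ht := (ENNReal.toReal_pos h0.ne' (θ.apply_ne_top 0)).ne'
  have hb := (ball_zero_one_pos hν h0 h1 hm hθ).ne'
  have h := quasiStat_succ hν h0 h1 hm hθ 0
  simp only [zero_add, pow_one, List.replicate_one] at h
  rw [h, div_self (div_ne_zero hb ht)]

variable [IsProbabilityMeasure ν]

/-- Total mass one of the law of the ball of radius 0, rescaled; it identifies Π(θ(0)). -/
theorem hasSum_quasiStat (hν : IsLocalLimit θ ν) (h0 : 0 < θ 0) (h1 : θ 0 < 1) (hm : mean θ ≤ 1)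
    (hθ : 0 < θ 1) : HasSum (fun p : ℕ => quasiStat θ (p + 1) * (θ 0).toReal ^ (p + 1))
      ((θ 0).toReal / ν.real {τ | τ.ball 0 = [node []]}) := by
  have ht := (ENNReal.toReal_pos h0.ne' (θ.apply_ne_top 0)).ne'
  have h := (hasSum_ball_zero ν).mul_right ((θ 0).toReal / ν.real {τ | τ.ball 0 = [node []]})
  rw [one_mul] at h
  refine h.congr_fun fun p => ?_
  rw [quasiStat_succ hν h0 h1 hm hθ]
  field_simp

theorem hasBallLaw0 (hν : IsLocalLimit θ ν) (h0 : 0 < θ 0) (h1 : θ 0 < 1) (hm : mean θ ≤ 1)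
    (hθ : 0 < θ 1) : HasBallLaw0 θ ν := by
  intro r f hf hr
  have ht := (ENNReal.toReal_pos h0.ne' (θ.apply_ne_top 0)).ne'
  have hb := (ball_zero_one_pos hν h0 h1 hm hθ).ne'
  obtain ⟨p, hp⟩ := Nat.exists_eq_succ_of_ne_zero (mt List.length_eq_zero_iff.1 hf)
  have hmean : (mean θ).toReal ≠ 0 := (ENNReal.toReal_pos
    ((growth_pos θ h0 h1 0).trans_le (growth_le_mean θ 0)).ne'
    (ne_top_of_le_ne_top ENNReal.one_ne_top hm)).ne'
  -- P(X(n) = p)/h_{n+r} is the quotient of P(X(n) = p)/h_n by h_{n+r}/h_n → m^r; uniqueness of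
  -- limits concludes.
  have h2 := ((tendsto_ball_zero hν h0 p).div (tendsto_heightMass_ratio θ h0 h1 hm r)
    (pow_ne_zero r hmean)).mul_const (forestWeight θ f).toReal
  have h3 := tendsto_nhds_unique (tendsto_ball hν hf hr) (h2.congr fun n => ?_)
  · rw [h3, quasiStatGenFun, (hasSum_quasiStat hν h0 h1 hm hθ).tsum_eq, hp,
      quasiStat_succ hν h0 h1 hm hθ]
    field_simp
  · have hh := (ENNReal.toReal_pos (heightMass_pos θ h0 h1 n).ne' (heightMass_ne_top θ n)).ne'
    rw [Pi.div_apply, div_div_div_cancel_right₀ hh, hp]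
    ring

theorem oneAtZero_eq : oneAtZero = {τ | τ.ball 0 = [node []]} := by
  ext τ
  constructor
  · intro h
    have h3 := eq_replicate_of_forestHeight_eq_zero (τ.ball_ne_nil 0) (τ.height_ball 0)
    rwa [show (τ.ball 0).length = 1 from h] at h3
  · intro h
    change (τ.ball 0).length = 1
    rw [show τ.ball 0 = [node []] from h]
    rfl

theorem measurableSet_oneAtZero : MeasurableSet oneAtZero :=
  InfiniteReverseTree.measurable_ball 0 (t := {f | f.length = 1}) .of_discrete

theorem hasBallLaw1 (hν : IsLocalLimit θ ν) (h0 : 0 < θ 0) (h1 : θ 0 < 1) (hm : mean θ ≤ 1)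
    (hθ : 0 < θ 1) : HasBallLaw1 θ (ν[|oneAtZero]) := by
  intro r f hf hr hone
  have ht := (ENNReal.toReal_pos h0.ne' (θ.apply_ne_top 0)).ne'
  have hb := (ball_zero_one_pos hν h0 h1 hm hθ).ne'
  have hsub : {τ : InfiniteReverseTree | τ.ball r = f} ⊆ oneAtZero := by
    rintro τ rfl
    rw [τ.length_descend_ball] at hone
    exact hone
  rw [Measure.real, cond_apply measurableSet_oneAtZero, Set.inter_eq_right.2 hsub,
    ENNReal.toReal_mul, ENNReal.toReal_inv, ← Measure.real, ← Measure.real,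
    hasBallLaw0 hν h0 h1 hm hθ r f hf hr, oneAtZero_eq, quasiStatGenFun,
    (hasSum_quasiStat hν h0 h1 hm hθ).tsum_eq]
  field_simp

end LocalLimit

/-- The law of `τ¹` is characterized by the laws of its balls. -/
theorem HasBallLaw1.unique {θ : PMF ℕ} {ν ν' : Measure InfiniteReverseTree}
    [IsProbabilityMeasure ν] [IsProbabilityMeasure ν'] (h0 : 0 < θ 0) (hq : quasiStat θ 1 = 1)
    (h : HasBallLaw1 θ ν) (h' : HasBallLaw1 θ ν') : ν = ν' := by
  have ht := (ENNReal.toReal_pos h0.ne' (θ.apply_ne_top 0)).ne'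
  have key : ∀ ρ : Measure InfiniteReverseTree, IsProbabilityMeasure ρ → HasBallLaw1 θ ρ →
      ρ oneAtZeroᶜ = 0 := by
    intro ρ hρ h
    rw [prob_compl_eq_zero_iff measurableSet_oneAtZero, oneAtZero_eq]
    -- The formula for a single vertex gives θ(0)/θ(0) = 1 because π(1) = 1. So the law is carried
    -- by `oneAtZero`, and the balls not covered by the formula are null.
    have h2 := h 0 [node []] (by simp) (forestHeight_replicate 0) rfl
    rw [List.length_singleton, hq, forestWeight_cons, forestWeight_nil, weight_node] at h2
    simp only [pow_zero, inv_one, mul_one, List.length_nil, forestWeight_nil] at h2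
    rw [one_div, inv_mul_cancel₀ ht, Measure.real, ENNReal.toReal_eq_one_iff] at h2
    exact h2
  refine InfiniteReverseTree.ext_of_ball fun r f hf hr => ?_
  by_cases hone : (descend r f).length = 1
  · rw [h r f hf hr hone, h' r f hf hr hone]
  · have hsub : {τ : InfiniteReverseTree | τ.ball r = f} ⊆ oneAtZeroᶜ := by
      rintro τ rfl hτ
      rw [τ.length_descend_ball] at hone
      exact hone hτ
    rw [Measure.real, Measure.real, measure_mono_null hsub (key ν inferInstance h),
      measure_mono_null hsub (key ν' inferInstance h')]

-- Existence of the spine variables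

/-- The laws of the independent variables used in the spine construction: a pair of numbers for
the degrees, a tree for the grafted trees. -/
noncomputable def spineLaw (θ : PMF ℕ) : SpineIndex → Measure ((ℕ × ℕ) × PlaneTree)
  | .degree r => Measure.sum fun p : ℕ × ℕ => ((growth θ r)⁻¹ * (θ (p.1 + p.2 + 1) *
      (extinctMass θ r ^ p.1 * extinctMass θ (r + 1) ^ p.2))) • Measure.dirac (p, node [])
  | .left r _ => ((treeLaw θ)[|{T | T.height ≤ r}]).map fun T => ((0, 0), T)
  | .right r _ => ((treeLaw θ)[|{T | T.height ≤ r}]).map fun T => ((0, 0), T)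

theorem isProbabilityMeasure_spineLaw (θ : PMF ℕ) (h0 : 0 < θ 0) (h1 : θ 0 < 1)
    (hm : mean θ ≤ 1) (i : SpineIndex) : IsProbabilityMeasure (spineLaw θ i) := by
  have hc : ∀ r, IsProbabilityMeasure ((treeLaw θ)[|{T | T.height ≤ r}]) := by
    intro r
    have h2 : treeLaw θ {T | T.height ≤ r} = extinctMass θ (r + 1) := by
      simp_rw [extinctMass, Nat.lt_succ_iff]
    exact cond_isProbabilityMeasure_of_finite (h2 ▸ (extinctMass_succ_pos θ h0 h1 r).ne')
      (h2 ▸ extinctMass_ne_top θ _)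
  cases i with
  | degree r =>
    constructor
    rw [spineLaw, Measure.sum_apply _ .univ]
    simp only [Measure.smul_apply, measure_univ, smul_eq_mul, mul_one, ENNReal.tsum_mul_left]
    rw [ENNReal.tsum_prod (f := fun i j => θ (i + j + 1) *
      (extinctMass θ r ^ i * extinctMass θ (r + 1) ^ j)), ← divDiff, ← growth]
    exact ENNReal.inv_mul_cancel (growth_pos θ h0 h1 r).ne'
      ((growth_le_mean θ r).trans_lt (hm.trans_lt ENNReal.one_lt_top)).ne
  | left r j =>
    have := hc r
    exact Measure.isProbabilityMeasure_map Measurable.of_discrete.aemeasurable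
  | right r j =>
    have := hc r
    exact Measure.isProbabilityMeasure_map Measurable.of_discrete.aemeasurable

/-- Coordinates of an infinite product. All factors share one state space, whose irrelevant
component is filled with a dummy value. -/
theorem exists_isSpineConstruction (θ : PMF ℕ) (h0 : 0 < θ 0) (h1 : θ 0 < 1)
    (hm : mean θ ≤ 1) :
    ∃ (Ω : Type) (_ : MeasurableSpace Ω) (P : Measure Ω) (_ : IsProbabilityMeasure P)
      (L R : ℕ → Ω → ℕ) (t u : ℕ → ℕ → Ω → PlaneTree), IsSpineConstruction θ P L R t u := by
  have hp := isProbabilityMeasure_spineLaw θ h0 h1 hm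
  let P := Measure.infinitePi (spineLaw θ)
  have hev : ∀ i, P.map (fun ω => ω i) = spineLaw θ i := fun i =>
    Measure.infinitePi_map_eval (spineLaw θ) i
  have hme : ∀ i, Measurable fun ω : SpineIndex → (ℕ × ℕ) × PlaneTree => ω i :=
    fun i => measurable_pi_apply i
  have hind : iIndepFun (fun i (ω : SpineIndex → (ℕ × ℕ) × PlaneTree) => ω i) P := by
    rw [iIndepFun_iff_map_fun_eq_infinitePi_map hme]
    simp_rw [hev]
    exact Measure.map_id
  refine ⟨SpineIndex → (ℕ × ℕ) × PlaneTree, inferInstance, P, inferInstance,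
    fun r ω => match r with
      | 0 => 0
      | r + 1 => (ω (.degree r)).1.1,
    fun r ω => match r with
      | 0 => 0
      | r + 1 => (ω (.degree r)).1.2,
    fun r j ω => match r with
      | r + 2 => (ω (.left r j)).2
      -- The families `t 0` and `t 1` carry no constraint and are taken constant.
      | _ => node [],
    fun r j ω => match r with
      | 0 => node []
      | r + 1 => (ω (.right r j)).2, ?_, ?_, ?_, ?_, ?_, ?_, ?_, ?_⟩
  · rintro (_ | r)
    · exact measurable_const
    · exact (hme _).fst.fst
  · rintro (_ | r)
    · exact measurable_const
    · exact (hme _).fst.snd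
  · rintro (_ | _ | r) j
    · exact measurable_const
    · exact measurable_const
    · exact (hme _).snd
  · rintro (_ | r) j
    · exact measurable_const
    · exact (hme _).snd
  · intro r i j
    have h2 : P {ω | (ω (.degree r)).1.1 = i ∧ (ω (.degree r)).1.2 = j} =
        (growth θ r)⁻¹ * (θ (i + j + 1) * (extinctMass θ r ^ i * extinctMass θ (r + 1) ^ j)) := by
      have h3 := Measure.map_apply (μ := P) (hme (.degree r))
        (s := {y | y.1.1 = i ∧ y.1.2 = j}) .of_discrete
      refine h3.symm.trans ?_
      rw [hev, spineLaw, Measure.sum_apply _ .of_discrete, tsum_eq_single (i, j)]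
      · simp
      · rintro ⟨a, b⟩ hab
        rw [Measure.smul_apply, Measure.dirac_apply' _ .of_discrete, Set.indicator_of_notMem,
          smul_zero]
        rintro ⟨rfl, rfl⟩
        exact hab rfl
    have hh := (ENNReal.toReal_pos (heightMass_pos θ h0 h1 r).ne' (heightMass_ne_top θ r)).ne'
    rw [extinct_succ_sub, extinct_succ_sub, heightMass_succ, extinct_eq, extinct_eq]
    refine (congrArg ENNReal.toReal h2).trans ?_
    simp only [ENNReal.toReal_mul, ENNReal.toReal_inv, ENNReal.toReal_pow]
    rw [div_mul_cancel_right₀ hh]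
    ring
  · intro r j
    have h2 := Measure.map_map (μ := P) (measurable_snd (α := ℕ × ℕ) (β := PlaneTree))
      (hme (.left r j))
    refine h2.symm.trans ?_
    rw [hev, spineLaw, Measure.map_map measurable_snd .of_discrete]
    exact Measure.map_id
  · intro r j
    have h2 := Measure.map_map (μ := P) (measurable_snd (α := ℕ × ℕ) (β := PlaneTree))
      (hme (.right r j))
    refine h2.symm.trans ?_
    rw [hev, spineLaw, Measure.map_map measurable_snd .of_discrete]
    exact Measure.map_id
  · refine iIndep_of_iIndep_of_le hind.iIndep fun i => ?_
    cases i with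
    | degree r =>
      rintro _ ⟨S, -, rfl⟩
      exact ⟨{y | (y.1.1, y.1.2) ∈ S}, .of_discrete, rfl⟩
    | left r j =>
      rintro _ ⟨S, -, rfl⟩
      exact ⟨{y | y.2 ∈ S}, .of_discrete, rfl⟩
    | right r j =>
      rintro _ ⟨S, -, rfl⟩
      exact ⟨{y | y.2 ∈ S}, .of_discrete, rfl⟩

/-- The law of the tree obtained from a spine is the local limit of Galton-Watson trees
conditioned on their height. -/
theorem IsSpineConstruction.exists_localLimit {θ : PMF ℕ} {Ω : Type*} [MeasurableSpace Ω]
    {P : Measure Ω} [IsProbabilityMeasure P] {L R : ℕ → Ω → ℕ} {t u : ℕ → ℕ → Ω → PlaneTree}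
    (hC : IsSpineConstruction θ P L R t u) (h0 : 0 < θ 0) (h1 : θ 0 < 1) (hm : mean θ ≤ 1) :
    ∃ τ : Ω → InfiniteReverseTree, Measurable τ ∧
      (∀ᵐ ω ∂P, IsSpineTree (fun r => L r ω) (fun r => R r ω) (fun r j => t r j ω)
        (fun r j => u r j ω) (τ ω)) ∧
      (∀ (r : ℕ) (A : Set (List PlaneTree)), Tendsto (fun n : ℕ =>
        ((treeLaw θ)[|{T | T.height = n}]).real {T | descend (n - r) [T] ∈ A}) atTop
        (𝓝 (P.real {ω | (τ ω).ball r ∈ A}))) ∧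
      IsLocalLimit θ (P.map τ) := by
  obtain ⟨τ, hτ, hlim⟩ := hC.exists_limit h0 h1 hm
  refine ⟨τ, hτ, ?_, hC.tendsto_cond_height h0 h1 hm hτ hlim, fun r A => ?_⟩
  · filter_upwards [hlim, hC.ae_spineSubtree_eq h0 h1 hm] with ω h2 h3
    intro r
    rw [h3]
    exact h2 r
  · have h4 : (P.map τ).real {τ | τ.ball r ∈ A} = P.real {ω | (τ ω).ball r ∈ A} := by
      exact congrArg ENNReal.toReal (Measure.map_apply hτ
        (InfiniteReverseTree.measurable_ball r (t := A) .of_discrete))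
    rw [h4]
    exact hC.tendsto_cond_height h0 h1 hm hτ hlim r A

end GaltonWatson

theorem mainTheorem6 (θ : PMF ℕ) (h0 : 0 < θ 0) (h1 : θ 0 < 1)
    (hm : GaltonWatson.mean θ ≤ 1) :
    -- the random variables of the spine construction exist
    (∃ (Ω : Type) (_ : MeasurableSpace Ω) (P : Measure Ω) (_ : IsProbabilityMeasure P)
      (L R : ℕ → Ω → ℕ) (t u : ℕ → ℕ → Ω → PlaneTree),
      GaltonWatson.IsSpineConstruction θ P L R t u) ∧
    -- the quasi-stationary measure is well defined, with a finite generating function at `θ 0`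
    (0 < θ 1 →
      (∀ p : ℕ, 1 ≤ p →
        Tendsto (GaltonWatson.ratio θ p) atTop (𝓝 (GaltonWatson.quasiStat θ p))) ∧
      Summable fun p : ℕ => GaltonWatson.quasiStat θ (p + 1) * (θ 0).toReal ^ (p + 1)) ∧
    -- for every realization of the spine construction
    ∀ (Ω : Type*) [MeasurableSpace Ω] (P : Measure Ω) [IsProbabilityMeasure P]
      (L R : ℕ → Ω → ℕ) (t u : ℕ → ℕ → Ω → PlaneTree),
      GaltonWatson.IsSpineConstruction θ P L R t u →
      -- it almost surely produces an infinite reverse tree `τ0`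
      ∃ τ0 : Ω → InfiniteReverseTree, Measurable τ0 ∧
        (∀ᵐ ω ∂P, GaltonWatson.IsSpineTree (fun r => L r ω) (fun r => R r ω)
          (fun r j => t r j ω) (fun r j => u r j ω) (τ0 ω)) ∧
        -- it is the local limit, seen from the last generation, of Galton-Watson trees
        -- conditioned to have height exactly `n`
        (∀ (r : ℕ) (A : Set (List PlaneTree)),
          Tendsto (fun n : ℕ => ((GaltonWatson.treeLaw θ)[|{T | T.height = n}]).real
              {T | PlaneTree.descend (n - r) [T] ∈ A}) atTop
            (𝓝 (P.real {ω | (τ0 ω).ball r ∈ A}))) ∧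
        (0 < θ 1 →
          -- the law of `τ0` is characterized by the laws of its balls
          GaltonWatson.HasBallLaw0 θ (P.map τ0) ∧
          (∀ ν : Measure InfiniteReverseTree, IsProbabilityMeasure ν →
            GaltonWatson.HasBallLaw0 θ ν → ν = P.map τ0) ∧
          -- the same for the law of `τ0` conditioned on having one vertex at reverse height `0`
          0 < (P.map τ0) GaltonWatson.oneAtZero ∧
          GaltonWatson.HasBallLaw1 θ ((P.map τ0)[|GaltonWatson.oneAtZero]) ∧
          (∀ ν : Measure InfiniteReverseTree, IsProbabilityMeasure ν →
            GaltonWatson.HasBallLaw1 θ ν → ν = (P.map τ0)[|GaltonWatson.oneAtZero])) := by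
  refine ⟨GaltonWatson.exists_isSpineConstruction θ h0 h1 hm, fun hθ => ?_, ?_⟩
  -- The measure π depends on θ alone, so any one realization may be used to read off the limits.
  · obtain ⟨Ω, _, P, _, L, R, t, u, hC⟩ := GaltonWatson.exists_isSpineConstruction θ h0 h1 hm
    obtain ⟨τ, hτ, -, -, hν⟩ := hC.exists_localLimit h0 h1 hm
    have := Measure.isProbabilityMeasure_map (μ := P) hτ.aemeasurable
    refine ⟨fun p hp => ?_, (GaltonWatson.hasSum_quasiStat hν h0 h1 hm hθ).summable⟩
    obtain ⟨p, rfl⟩ := Nat.exists_eq_succ_of_ne_zero (Nat.one_le_iff_ne_zero.1 hp)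
    rw [Nat.succ_eq_add_one, GaltonWatson.quasiStat_succ hν h0 h1 hm hθ]
    exact GaltonWatson.tendsto_ratio hν h0 h1 hm hθ p
  · intro Ω _ P _ L R t u hC
    obtain ⟨τ, hτ, hspine, hlim, hν⟩ := hC.exists_localLimit h0 h1 hm
    have := Measure.isProbabilityMeasure_map (μ := P) hτ.aemeasurable
    refine ⟨τ, hτ, hspine, hlim, fun hθ => ?_⟩
    have hlaw := GaltonWatson.hasBallLaw0 hν h0 h1 hm hθ
    have hpos : 0 < (P.map τ) GaltonWatson.oneAtZero := by
      rw [GaltonWatson.oneAtZero_eq]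
      exact (ENNReal.toReal_pos_iff.1 (GaltonWatson.ball_zero_one_pos hν h0 h1 hm hθ)).1
    have hlaw1 := GaltonWatson.hasBallLaw1 hν h0 h1 hm hθ
    refine ⟨hlaw, fun ν _ h => ?_, hpos, hlaw1, fun ν _ h => ?_⟩
    · refine InfiniteReverseTree.ext_of_ball fun r f hf hr => ?_
      rw [h r f hf hr, hlaw r f hf hr]
    · have := cond_isProbabilityMeasure (μ := P.map τ) hpos.ne'
      exact h.unique h0 (GaltonWatson.quasiStat_one hν h0 h1 hm hθ) hlaw1
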